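/- Let $(\Omega,\mathcal F,\mathbb P)$ be a probability space with a filtration $\mathbb F=(\mathcal F_t)_{t\ge 0}$, let $W=\{W(t),t\ge 0\}$ be a real Wiener process with respect to $\mathbb F$ (that is, $W$ is a standard Brownian motion adapted to $\mathbb F$ and $W(t)-W(s)$ is independent of $\mathcal F_s$ for $s\le t$; for instance $\mathbb F$ may be the filtration generated by $W$), and let $T>0$. Let $\vartheta=\{\vartheta(t),t\in[0,T]\}$ be a real-valued $\mathbb F$-progressively measurable process with $$\mathbb P\Big\{\int_0^T\vartheta^2(s)\,ds<\infty\Big\}=1,$$ and let $Z(t)=\int_0^t\vartheta(s)\,dW(s)$, $t\in[0,T]$, be its Itô integral process, taken with almost surely continuous paths. We say that a process $X$ is Hölder of order $\alpha$ if for almost every $\omega$ there is a finite constant $C(\omega)$ such that $|X(t,\omega)-X(s,\omega)|\le C(\omega)|t-s|^{\alpha}$ for all $s,t\in[0,T]$, and that it is Lipschitz if this holds with $\alpha=1$. (i) If $\mathbb P\{\sup_{0\le t\le T}|\vartheta(t)|\ge C\}\to 0$ as $C\to\infty$ (outer probability, if this set is not measurable), then $Z$ is Hölder of every order $\alpha\in(0,\tfrac12)$,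 and the quadratic characteristic $\int_0^t\vartheta^2(s)\,ds$, $t\in[0,T]$, is Lipschitz. (ii) If $\delta>0$ and $\sup_{t\in[0,T]}\mathbb E|\vartheta(t)|^{2+\delta}<\infty$, then $Z$ is Hölder of order $\frac{\delta}{4+2\delta}$, and $\int_0^t\vartheta^2(s)\,ds$ is Hölder of order $\frac{\delta}{2+\delta}$. (iii) If $\delta>0$ and $\mathbb E\int_0^T|\vartheta(t)|^{4+\delta}\,dt<\infty$, then $Z$ is Hölder of order $\frac{\delta}{8+2\delta}$, and $\int_0^t\vartheta^2(s)\,ds$ is Hölder of order $\frac{\delta}{4+\delta}$. -/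

import Mathlib

open MeasureTheory ProbabilityTheory Filter Topology
open scoped NNReal ENNReal

/-- `W` is a (real, standard) Wiener process with respect to the filtration `ℱ`: it is a Brownian
motion, it is adapted to `ℱ`, and its increments after time `s` are independent of `ℱ s`. -/
structure IsWienerProcess {Ω : Type*} {mΩ : MeasurableSpace Ω} (ℱ : Filtration ℝ≥0 mΩ)
    (W : ℝ≥0 → Ω → ℝ) (P : Measure Ω) : Prop extends IsBrownianReal W P where
  adapted : ∀ t, Measurable[ℱ t] (W t)
  indep_increment : ∀ s t, s ≤ t →
    Indep (MeasurableSpace.comap (fun ω ↦ W t ω - W s ω) inferInstance) (ℱ s) P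

/-- A simple process: `∑ i < n, ξ i * 𝟙_(τ i, τ (i + 1)]` with deterministic times
`τ 0 ≤ τ 1 ≤ …` and uniformly bounded `ℱ (τ i)`-measurable random variables `ξ i`. -/
structure SimpleProcess {Ω : Type*} {mΩ : MeasurableSpace Ω} (ℱ : Filtration ℝ≥0 mΩ) where
  n : ℕ
  τ : ℕ → ℝ≥0
  ξ : ℕ → Ω → ℝ
  mono : Monotone τ
  measurable : ∀ i, Measurable[ℱ (τ i)] (ξ i)
  bounded : ∃ M : ℝ, ∀ i ω, |ξ i ω| ≤ M

namespace SimpleProcess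

/-- The value of a simple process at time `s`. -/
noncomputable def eval {Ω : Type*} {mΩ : MeasurableSpace Ω} {ℱ : Filtration ℝ≥0 mΩ}
    (V : SimpleProcess ℱ) (s : ℝ≥0) (ω : Ω) : ℝ :=
  ∑ i ∈ Finset.range V.n, (Set.Ioc (V.τ i) (V.τ (i + 1))).indicator (fun _ ↦ V.ξ i ω) s

/-- The elementary stochastic integral `∫₀ᵗ V dW` of a simple process. -/
noncomputable def integral {Ω : Type*} {mΩ : MeasurableSpace Ω} {ℱ : Filtration ℝ≥0 mΩ}
    (V : SimpleProcess ℱ) (W : ℝ≥0 → Ω → ℝ) (t : ℝ≥0) (ω : Ω) : ℝ :=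
  ∑ i ∈ Finset.range V.n, V.ξ i ω * (W (min (V.τ (i + 1)) t) ω - W (min (V.τ i) t) ω)

end SimpleProcess

/-- `Z` is (a version with almost surely continuous paths of) the Itô integral process
`t ↦ ∫₀ᵗ ϑ dW` on `[0, T]`: there are simple processes `V k` with
`∫₀ᵀ |V k - ϑ|² ds → 0` in probability such that, for every `t ∈ [0, T]`, the random variable `Z t`
is the limit in probability of the elementary integrals `∫₀ᵗ V k dW`. For progressively measurable
`ϑ` with `∫₀ᵀ ϑ² ds < ∞` almost surely, such a `Z` is unique up to indistinguishability. -/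
structure IsItoIntegral {Ω : Type*} {mΩ : MeasurableSpace Ω} (ℱ : Filtration ℝ≥0 mΩ)
    (W : ℝ≥0 → Ω → ℝ) (P : Measure Ω) (T : ℝ≥0) (ϑ Z : ℝ≥0 → Ω → ℝ) : Prop where
  continuous_paths : ∀ᵐ ω ∂P, ContinuousOn (fun t ↦ Z t ω) (Set.Iic T)
  exists_approx : ∃ V : ℕ → SimpleProcess ℱ,
    (∀ ε : ℝ≥0∞, 0 < ε → Tendsto
      (fun k ↦ P {ω | ε ≤ ∫⁻ s in Set.Icc (0 : ℝ) T,
        ‖(V k).eval s.toNNReal ω - ϑ s.toNNReal ω‖ₑ ^ 2}) atTop (𝓝 0)) ∧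
    ∀ t ≤ T, TendstoInMeasure P (fun k ↦ (V k).integral W t) atTop (Z t)

/-- Almost every path of `X` is Hölder continuous of order `α` on `[0, T]`
(with a constant that may depend on the path). -/
def HasHolderPaths {Ω : Type*} {mΩ : MeasurableSpace Ω} (P : Measure Ω) (T : ℝ≥0)
    (X : ℝ≥0 → Ω → ℝ) (α : ℝ≥0) : Prop :=
  ∀ᵐ ω ∂P, ∃ C : ℝ≥0, HolderOnWith C α (fun t ↦ X t ω) (Set.Iic T)

/-- Almost every path of `X` is Lipschitz continuous on `[0, T]`
(with a constant that may depend on the path). -/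
def HasLipschitzPaths {Ω : Type*} {mΩ : MeasurableSpace Ω} (P : Measure Ω) (T : ℝ≥0)
    (X : ℝ≥0 → Ω → ℝ) : Prop :=
  ∀ᵐ ω ∂P, ∃ C : ℝ≥0, LipschitzOnWith C (fun t ↦ X t ω) (Set.Iic T)

/-- The quadratic characteristic `t ↦ ∫₀ᵗ ϑ² ds` of the Itô integral of `ϑ`. -/
noncomputable def quadChar {Ω : Type*} (ϑ : ℝ≥0 → Ω → ℝ) (t : ℝ≥0) (ω : Ω) : ℝ :=
  ∫ s in (0 : ℝ)..t, ϑ s.toNNReal ω ^ 2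

/-!
The exponents in the moment cases are the endpoints `1 / 2 - 1 / p` and `1 - 2 / p`, with
`p = 2 + δ`. For the quadratic characteristic the endpoint is Hölder's inequality on `[s, t]`. For
the integral `Z` the Kolmogorov criterion with the moment of order `p` only gives every exponent
below the endpoint; what reaches it is a real interpolation argument. At the dyadic scale `2⁻ⁿ` the
integrand `ϑ` is truncated at the height `2 ^ (n / p)`. The increment coming from the truncated
part is controlled by a moment of order `2 * (k + 1) > p`, the increment coming from the excess by
its quadratic characteristic, and the two resulting bounds, summed over all dyadic intervals of all
scales, are both at most a constant times `𝔼 ∫ (1 + |ϑ| ^ p)` (`tsum_clip_le`, `tsum_sub_clip_le`).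
Borel–Cantelli and dyadic chaining (`exists_holderOnWith_of_dyadic`) then give the Hölder bound.

No theory of the Itô integral beyond its definition as a limit in probability is needed. The basic
estimate is proved for elementary sums `∑ ξ i * ΔW i` and passes to the limit
(`IsItoIntegral.measure_increment_le`): the probability that an increment of `Z` is large, while the
quadratic characteristic of the excess is at most `K`, is bounded by a high moment of the truncated
integrand and by the mean of the quadratic characteristic of the excess, cut off at `K`. It rests
on two one-step recursions along the partition, each of which uses only that a Brownian increment
is Gaussian and independent of the past:
* `lintegral_elementarySum_pow_le`, a moment bound `𝔼 M ^ (2m) ≤ C h ^ (m - 1) 𝔼 ∑ ξ i ^ (2m) Δ i`;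
* `lintegral_elementarySum_sq_exp_le`, that is `𝔼 M² exp (-A / K) ≤ 𝔼 K (1 - exp (-A / K))` for the
  quadratic characteristic `A`, which gives a Lenglart inequality without stopping times.

When `ϑ` has almost surely bounded paths, the truncation height is a constant `N`. On the event that
`|ϑ| ≤ N` the excess vanishes, so that `K` may be taken as small as desired and no localisation of
`Z` is needed; moments of all orders give every exponent below `1 / 2`.
-/

/-! ### Gaussian one-step estimates -/

/-- A two-point inequality: symmetrisation removes the odd powers of `y`, so that the deviation from
`2 * x ^ (2 * n)` is of order `y ^ 2`. -/
theorem add_pow_add_sub_pow_le (n : ℕ) (x y : ℝ) :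
    (x + y) ^ (2 * n) + (x - y) ^ (2 * n) ≤ 2 * (x ^ 2 + (1 + 4 * n) * y ^ 2) ^ n := by
  suffices H : ∀ m ≤ n, (x + y) ^ (2 * m) + (x - y) ^ (2 * m)
        ≤ 2 * (x ^ 2 + (1 + 4 * n) * y ^ 2) ^ m ∧
      2 * (x * y) * ((x + y) ^ (2 * m) - (x - y) ^ (2 * m))
        ≤ 8 * m * (y ^ 2 * (x ^ 2 + (1 + 4 * n) * y ^ 2) ^ m) from (H n le_rfl).1
  intro m
  induction m with
  | zero => intro _; norm_num
  | succ m ih =>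
    intro hm
    obtain ⟨h1, h2⟩ := ih (by omega)
    have hmn : (m : ℝ) + 1 ≤ n := by exact_mod_cast hm
    set u := x ^ 2 + (1 + 4 * n) * y ^ 2 with hu
    have hn0 : (0 : ℝ) ≤ n := Nat.cast_nonneg n
    have hu0 : 0 ≤ u ^ m := by positivity
    have hxu : x ^ 2 + y ^ 2 ≤ u := by rw [hu]; nlinarith [sq_nonneg y]
    have hx2 : x ^ 2 ≤ u := by nlinarith [sq_nonneg y]
    have hs0 : (0 : ℝ) ≤ x ^ 2 + y ^ 2 := by positivity
    have e1 : (x + y) ^ (2 * (m + 1)) = (x + y) ^ (2 * m) * (x ^ 2 + y ^ 2 + 2 * (x * y)) := by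
      rw [show 2 * (m + 1) = 2 * m + 2 by ring, pow_add]; ring
    have e2 : (x - y) ^ (2 * (m + 1)) = (x - y) ^ (2 * m) * (x ^ 2 + y ^ 2 - 2 * (x * y)) := by
      rw [show 2 * (m + 1) = 2 * m + 2 by ring, pow_add]; ring
    rw [e1, e2, pow_succ u m]
    generalize (x + y) ^ (2 * m) = p at *
    generalize (x - y) ^ (2 * m) = q at *
    generalize u ^ m = U at *
    have a1 := mul_le_mul_of_nonneg_right h1 hs0
    have hy : 0 ≤ y ^ 2 * U := by positivity
    constructor
    · have h3 : 2 * U * (x ^ 2 + y ^ 2) + 8 * m * (y ^ 2 * U) ≤ 2 * (U * u) := by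
        rw [hu]; nlinarith [mul_le_mul_of_nonneg_right hmn hy]
      nlinarith
    · have a2 := mul_le_mul_of_nonneg_right h2 hs0
      have a3 : 8 * m * (y ^ 2 * U) * (x ^ 2 + y ^ 2) ≤ 8 * m * (y ^ 2 * U) * u := by gcongr
      have a4 := mul_le_mul_of_nonneg_left h1 (by positivity : 0 ≤ 4 * (x ^ 2 * y ^ 2))
      have a5 : x ^ 2 * (y ^ 2 * U) ≤ u * (y ^ 2 * U) := by gcongr
      push_cast
      nlinarith

/-- Convexity of `x ↦ x ^ (k + 1)` with the weights `1 / (1 + η)` and `η / (1 + η)`. With `η` the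
relative length of a time step, the factors `(1 + η) ^ k` multiply up to a bounded product. -/
theorem add_pow_succ_le_weighted {a b η : ℝ} (ha : 0 ≤ a) (hb : 0 ≤ b) (hη : 0 < η) (k : ℕ) :
    (a + b) ^ (k + 1) ≤ (1 + η) ^ k * a ^ (k + 1) + (1 + 1 / η) ^ k * b ^ (k + 1) := by
  have hc : ConvexOn ℝ (Set.Ici 0) fun x : ℝ ↦ x ^ (k + 1) := convexOn_pow (k + 1)
  have h := hc.2 (show (1 + η) * a ∈ Set.Ici 0 by simp only [Set.mem_Ici]; positivity)
    (show (1 + 1 / η) * b ∈ Set.Ici 0 by simp only [Set.mem_Ici]; positivity)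
    (show 0 ≤ 1 / (1 + η) by positivity) (show 0 ≤ η / (1 + η) by positivity) (by field_simp)
  simp only [smul_eq_mul, mul_pow] at h
  have e1 : 1 / (1 + η) * ((1 + η) * a) + η / (1 + η) * ((1 + 1 / η) * b) = a + b := by
    field_simp; ring
  have e2 : 1 / (1 + η) * ((1 + η) ^ (k + 1) * a ^ (k + 1)) = (1 + η) ^ k * a ^ (k + 1) := by
    rw [pow_succ (1 + η)]; field_simp
  have e3 : η / (1 + η) * ((1 + 1 / η) ^ (k + 1) * b ^ (k + 1))
      = (1 + 1 / η) ^ k * b ^ (k + 1) := by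
    rw [pow_succ (1 + 1 / η)]; field_simp; ring
  rwa [e1, e2, e3] at h

/-- The absolute moment of order `2 * n` of the standard Gaussian distribution. -/
noncomputable def gaussianEvenMoment (n : ℕ) : ℝ≥0∞ :=
  ∫⁻ z, ENNReal.ofReal (z ^ (2 * n)) ∂(gaussianReal 0 1)

theorem gaussianEvenMoment_lt_top (n : ℕ) : gaussianEvenMoment n < ∞ := by
  have h : MemLp id ((2 * n : ℕ) : ℝ≥0∞) (gaussianReal 0 1) :=
    memLp_id_gaussianReal' _ (ENNReal.natCast_ne_top _)
  have h2 := h.integrable_norm_pow'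
  have h3 : Integrable (fun z : ℝ ↦ z ^ (2 * n)) (gaussianReal 0 1) := by
    refine h2.congr (ae_of_all _ fun z ↦ ?_)
    simp only [id, Real.norm_eq_abs, pow_mul, sq_abs]
  simpa [gaussianEvenMoment] using h3.lintegral_lt_top

theorem lintegral_gaussianReal_even_pow (n : ℕ) (v : ℝ≥0) :
    ∫⁻ z, ENNReal.ofReal (z ^ (2 * n)) ∂(gaussianReal 0 v)
      = ENNReal.ofReal ((v : ℝ) ^ n) * gaussianEvenMoment n := by
  have h := gaussianReal_map_const_mul (μ := 0) (v := 1) (Real.sqrt v)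
  have hv : gaussianReal 0 v = (gaussianReal 0 1).map (Real.sqrt v * ·) := by
    rw [h]; congr 1
    · simp
    · ext; simp
  rw [hv, lintegral_map (by fun_prop) (by fun_prop), gaussianEvenMoment,
    ← lintegral_const_mul _ (by fun_prop)]
  refine lintegral_congr fun z ↦ ?_
  rw [← ENNReal.ofReal_mul (by positivity), mul_pow, pow_mul (Real.sqrt v),
    Real.sq_sqrt v.coe_nonneg]

theorem lintegral_gaussianReal_symm (v : ℝ≥0) {f : ℝ → ℝ≥0∞} (hf : Measurable f) :
    ∫⁻ z, f (-z) ∂(gaussianReal 0 v) = ∫⁻ z, f z ∂(gaussianReal 0 v) := by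
  have h := gaussianReal_map_neg (μ := 0) (v := v)
  rw [neg_zero] at h
  conv_rhs => rw [← h, lintegral_map hf (by fun_prop)]

/-- The constant in `lintegral_gaussianReal_affine_pow_le`. -/
noncomputable def momentConst (k : ℕ) : ℝ≥0∞ :=
  ENNReal.ofReal (2 ^ k * (1 + 4 * ((k + 1 : ℕ) : ℝ)) ^ (k + 1)) * gaussianEvenMoment (k + 1)

theorem momentConst_lt_top (k : ℕ) : momentConst k < ∞ :=
  ENNReal.mul_lt_top ENNReal.ofReal_lt_top (gaussianEvenMoment_lt_top _)

/-- The effect of one time step of length `d`, inside an interval of length `h`, on a moment of even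
order: a growth factor that is harmless after multiplication over all steps, plus a term
proportional to `d`. -/
theorem lintegral_gaussianReal_affine_pow_le (k : ℕ) {h : ℝ} (hh : 0 < h) {d : ℝ≥0}
    (hd : (d : ℝ) ≤ h) (x v : ℝ) :
    ∫⁻ z, ENNReal.ofReal ((x + v * z) ^ (2 * (k + 1))) ∂(gaussianReal 0 d)
      ≤ ENNReal.ofReal ((1 + d / h) ^ k) * ENNReal.ofReal (x ^ (2 * (k + 1)))
        + momentConst k * ENNReal.ofReal (h ^ k * (d * v ^ (2 * (k + 1)))) := by
  rcases eq_or_lt_of_le (zero_le (a := d)) with h0 | h0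
  · subst h0
    simp
  have hd0 : (0 : ℝ) < d := h0
  set D : ℝ := 1 + 4 * ((k + 1 : ℕ) : ℝ) with hD
  have hD0 : 0 ≤ D := by positivity
  -- pointwise bound for the symmetrised integrand
  have key : ∀ z : ℝ, (x + v * z) ^ (2 * (k + 1)) + (x - v * z) ^ (2 * (k + 1)) ≤
      2 * ((1 + d / h) ^ k * x ^ (2 * (k + 1))
        + (2 * h / d) ^ k * (D ^ (k + 1) * v ^ (2 * (k + 1))) * z ^ (2 * (k + 1))) := by
    intro z
    refine (add_pow_add_sub_pow_le (k + 1) x (v * z)).trans ?_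
    have h1 := add_pow_succ_le_weighted (a := x ^ 2) (b := D * (v * z) ^ 2) (η := d / h)
      (by positivity) (by positivity) (by positivity) k
    have h2 : (1 + 1 / (d / h)) ^ k ≤ (2 * h / d) ^ k := by
      gcongr
      rw [one_div_div, mul_div_assoc]
      have : 1 ≤ h / d := (one_le_div hd0).2 hd
      linarith
    have e : (D * (v * z) ^ 2) ^ (k + 1)
        = D ^ (k + 1) * v ^ (2 * (k + 1)) * z ^ (2 * (k + 1)) := by
      rw [mul_pow, ← pow_mul, mul_pow]; ring
    have h3 := mul_le_mul_of_nonneg_right h2 (by positivity : 0 ≤ (D * (v * z) ^ 2) ^ (k + 1))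
    rw [← pow_mul x] at h1
    rw [e] at h1 h3
    rw [← hD]
    nlinarith
  have hm : Measurable fun z : ℝ ↦ ENNReal.ofReal ((x + v * z) ^ (2 * (k + 1))) := by fun_prop
  have hsym := lintegral_gaussianReal_symm d hm
  -- the Gaussian law is symmetric, so twice the integral is that of the symmetrised integrand
  have htwo : 2 * ∫⁻ z, ENNReal.ofReal ((x + v * z) ^ (2 * (k + 1))) ∂(gaussianReal 0 d) ≤
      2 * (ENNReal.ofReal ((1 + d / h) ^ k) * ENNReal.ofReal (x ^ (2 * (k + 1)))
        + momentConst k * ENNReal.ofReal (h ^ k * (d * v ^ (2 * (k + 1))))) := by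
    rw [two_mul]
    nth_rewrite 2 [← hsym]
    rw [← lintegral_add_left hm]
    calc _ ≤ ∫⁻ z, (2 * (ENNReal.ofReal ((1 + d / h) ^ k * x ^ (2 * (k + 1))) +
          ENNReal.ofReal ((2 * h / d) ^ k * (D ^ (k + 1) * v ^ (2 * (k + 1))))
            * ENNReal.ofReal (z ^ (2 * (k + 1))))) ∂(gaussianReal 0 d) := by
          refine lintegral_mono fun z ↦ ?_
          have p1 : 0 ≤ v ^ (2 * (k + 1)) := by rw [pow_mul]; positivity
          have p2 : 0 ≤ z ^ (2 * (k + 1)) := by rw [pow_mul]; positivity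
          have p3 : 0 ≤ x ^ (2 * (k + 1)) := by rw [pow_mul]; positivity
          have p4 : 0 ≤ (x + v * z) ^ (2 * (k + 1)) := by rw [pow_mul]; positivity
          have p5 : 0 ≤ (x + v * -z) ^ (2 * (k + 1)) := by rw [pow_mul]; positivity
          dsimp only
          rw [← ENNReal.ofReal_add p4 p5, ← ENNReal.ofReal_mul (by positivity),
            ← ENNReal.ofReal_add (by positivity) (by positivity),
            ← ENNReal.ofReal_ofNat 2, ← ENNReal.ofReal_mul (by positivity)]
          refine ENNReal.ofReal_le_ofReal ?_
          have := key z
          rwa [show x + v * -z = x - v * z by ring]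
      _ = _ := by
          have p1 : 0 ≤ v ^ (2 * (k + 1)) := by rw [pow_mul]; positivity
          rw [lintegral_const_mul _ (by fun_prop), lintegral_add_left (by fun_prop),
            lintegral_const_mul _ (by fun_prop), lintegral_gaussianReal_even_pow]
          simp only [lintegral_const, measure_univ, mul_one]
          rw [ENNReal.ofReal_mul (by positivity), ← mul_assoc (ENNReal.ofReal _)
            (ENNReal.ofReal _) (gaussianEvenMoment _), momentConst,
            ← ENNReal.ofReal_mul (by positivity),
            ← ENNReal.ofReal_mul (by positivity)]
          have e5 : (2 * h / d) ^ k * (D ^ (k + 1) * v ^ (2 * (k + 1))) * (d : ℝ) ^ (k + 1)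
              = 2 ^ k * D ^ (k + 1) * (h ^ k * (d * v ^ (2 * (k + 1)))) := by
            rw [div_pow, mul_pow]; field_simp; ring
          rw [e5, ENNReal.ofReal_mul (p := 2 ^ k * D ^ (k + 1)) (by positivity),
            mul_right_comm]
  exact (ENNReal.mul_le_mul_iff_right (by simp) (by simp)).1 htwo

theorem lintegral_gaussianReal_affine_sq (d : ℝ≥0) (x v : ℝ) :
    ∫⁻ z, ENNReal.ofReal ((x + v * z) ^ 2) ∂(gaussianReal 0 d)
      = ENNReal.ofReal (x ^ 2 + v ^ 2 * d) := by
  have h1 : Integrable (fun z : ℝ ↦ z) (gaussianReal 0 d) :=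
    (memLp_id_gaussianReal 1).integrable (by simp)
  have h2 : Integrable (fun z : ℝ ↦ z ^ 2) (gaussianReal 0 d) :=
    (memLp_id_gaussianReal 2).integrable_sq
  have hv : ∫ z, z ^ 2 ∂(gaussianReal 0 d) = d := by
    have := variance_eq_integral (μ := gaussianReal 0 d) (X := id) (by fun_prop)
    simpa [variance_id_gaussianReal] using this.symm
  have e : ∀ z : ℝ, (x + v * z) ^ 2 = x ^ 2 + (2 * x * v) * z + v ^ 2 * z ^ 2 := fun z ↦ by ring
  have h3 : Integrable (fun _ : ℝ ↦ x ^ 2) (gaussianReal 0 d) := integrable_const _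
  have h4 : Integrable (fun z : ℝ ↦ (2 * x * v) * z) (gaussianReal 0 d) := h1.const_mul _
  have h5 : Integrable (fun z : ℝ ↦ v ^ 2 * z ^ 2) (gaussianReal 0 d) := h2.const_mul _
  rw [← ofReal_integral_eq_lintegral_ofReal]
  · congr 1
    simp_rw [e]
    have i1 := integral_add (h3.add h4) h5
    simp only [Pi.add_apply] at i1
    rw [i1, integral_add h3 h4,
      integral_const_mul, integral_const_mul, hv]
    simp
  · simp_rw [e]; exact (h3.add h4).add h5
  · exact ae_of_all _ fun z ↦ sq_nonneg _

/-! ### Moments of elementary integrals -/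

section Increments

variable {Ω : Type*} {mΩ : MeasurableSpace Ω} {P : Measure Ω}
  {ℱ : Filtration ℝ≥0 mΩ} {W : ℝ≥0 → Ω → ℝ}

/-- Integrating out a Brownian increment that is independent of the past. -/
theorem IsWienerProcess.lintegral_increment [IsProbabilityMeasure P] {E : Type*} [MeasurableSpace E]
    (hW : IsWienerProcess ℱ W P) {s t : ℝ≥0} (hst : s ≤ t) {X : Ω → E}
    (hX : Measurable[ℱ s] X) {G : E → ℝ → ℝ≥0∞} (hG : Measurable (Function.uncurry G)) :
    ∫⁻ ω, G (X ω) (W t ω - W s ω) ∂P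
      = ∫⁻ ω, (∫⁻ z, G (X ω) z ∂(gaussianReal 0 (t - s))) ∂P := by
  have hXm : Measurable X := hX.mono (ℱ.le s) le_rfl
  have hWm : ∀ r, Measurable (W r) := fun r ↦ (hW.adapted r).mono (ℱ.le r) le_rfl
  have hY : Measurable (fun ω ↦ W t ω - W s ω) := (hWm t).sub (hWm s)
  have hind : IndepFun X (fun ω ↦ W t ω - W s ω) P := by
    have h := (hW.indep_increment s t hst).symm
    exact indep_of_indep_of_le_left h hX.comap_le
  have hmap := (indepFun_iff_map_prod_eq_prod_map_map hXm.aemeasurable hY.aemeasurable).1 hind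
  have hlaw : P.map (fun ω ↦ W t ω - W s ω) = gaussianReal 0 (t - s) := by
    have h := (hW.toIsPreBrownianReal.hasLaw_sub t s).map_eq
    have hd : nndist (t : ℝ) s = t - s := by
      ext
      rw [coe_nndist, Real.dist_eq, NNReal.coe_sub hst,
        abs_of_nonneg (sub_nonneg.2 (NNReal.coe_le_coe.2 hst))]
    rw [← hd]
    exact h
  have := Measure.isProbabilityMeasure_map (μ := P) hXm.aemeasurable
  calc ∫⁻ ω, G (X ω) (W t ω - W s ω) ∂P
      = ∫⁻ p, Function.uncurry G p ∂(P.map fun ω ↦ (X ω, W t ω - W s ω)) := by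
        rw [lintegral_map hG (hXm.prodMk hY)]; rfl
    _ = ∫⁻ x, ∫⁻ z, G x z ∂(gaussianReal 0 (t - s)) ∂(P.map X) := by
        rw [hmap, hlaw, lintegral_prod _ hG.aemeasurable]; rfl
    _ = _ := by
        rw [lintegral_map _ hXm]
        exact hG.lintegral_prod_right'

/-- The elementary integral `∑ i < n, ξ i * (W (σ (i + 1)) - W (σ i))`. -/
noncomputable def elementarySum (W : ℝ≥0 → Ω → ℝ) (σ : ℕ → ℝ≥0) (ξ : ℕ → Ω → ℝ) (n : ℕ)
    (ω : Ω) : ℝ :=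
  ∑ i ∈ Finset.range n, ξ i ω * (W (σ (i + 1)) ω - W (σ i) ω)

/-- The quadratic characteristic of an elementary integral. -/
noncomputable def elementaryQuad (σ : ℕ → ℝ≥0) (ξ : ℕ → Ω → ℝ) (n : ℕ) (ω : Ω) : ℝ :=
  ∑ i ∈ Finset.range n, ξ i ω ^ 2 * ((σ (i + 1) : ℝ) - σ i)

variable {σ : ℕ → ℝ≥0} {ξ : ℕ → Ω → ℝ}

theorem measurable_elementarySum (hW : IsWienerProcess ℱ W P) (hσ : Monotone σ)
    (hξ : ∀ i, Measurable[ℱ (σ i)] (ξ i)) (n : ℕ) :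
    Measurable[ℱ (σ n)] (elementarySum W σ ξ n) := by
  unfold elementarySum
  refine Finset.measurable_fun_sum _ fun i hi ↦ ?_
  have hi' : i + 1 ≤ n := Finset.mem_range.1 hi
  have h1 : Measurable[ℱ (σ n)] (ξ i) := (hξ i).mono (ℱ.mono (hσ (by omega))) le_rfl
  have h2 : Measurable[ℱ (σ n)] (W (σ (i + 1))) :=
    (hW.adapted _).mono (ℱ.mono (hσ hi')) le_rfl
  have h3 : Measurable[ℱ (σ n)] (W (σ i)) := (hW.adapted _).mono (ℱ.mono (hσ (by omega))) le_rfl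
  exact h1.mul (h2.sub h3)

/-- The quadratic characteristic is predictable: its next value is already known at time `σ n`. -/
theorem measurable_elementaryQuad_succ (hσ : Monotone σ)
    (hξ : ∀ i, Measurable[ℱ (σ i)] (ξ i)) (n : ℕ) :
    Measurable[ℱ (σ n)] (elementaryQuad σ ξ (n + 1)) := by
  unfold elementaryQuad
  refine Finset.measurable_fun_sum _ fun i hi ↦ ?_
  have hi' : i ≤ n := Nat.lt_succ_iff.1 (Finset.mem_range.1 hi)
  have h1 : Measurable[ℱ (σ n)] (ξ i) := (hξ i).mono (ℱ.mono (hσ hi')) le_rfl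
  exact (h1.pow_const 2).mul_const _

/-- A moment inequality of Burkholder–Davis–Gundy type for elementary integrals, by a discrete
Gronwall argument. -/
theorem lintegral_elementarySum_pow_le [IsProbabilityMeasure P]
    (hW : IsWienerProcess ℱ W P) (hσ : Monotone σ)
    (hξ : ∀ i, Measurable[ℱ (σ i)] (ξ i)) (k n : ℕ) {h : ℝ} (hh : 0 < h)
    (hlen : (σ n : ℝ) - σ 0 ≤ h) :
    ∫⁻ ω, ENNReal.ofReal (elementarySum W σ ξ n ω ^ (2 * (k + 1))) ∂P
      ≤ ENNReal.ofReal (Real.exp k * h ^ k) * momentConst k *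
        ∫⁻ ω, ENNReal.ofReal
          (∑ i ∈ Finset.range n, ((σ (i + 1) : ℝ) - σ i) * ξ i ω ^ (2 * (k + 1))) ∂P := by
  have hd0 : ∀ i, (0 : ℝ) ≤ (σ (i + 1) : ℝ) - σ i := fun i ↦
    sub_nonneg.2 (NNReal.coe_le_coe.2 (hσ i.le_succ))
  have hpow : ∀ x : ℝ, 0 ≤ x ^ (2 * (k + 1)) := fun x ↦ by rw [pow_mul]; positivity
  have hξm : ∀ i, Measurable (ξ i) := fun i ↦ (hξ i).mono (ℱ.le _) le_rfl
  suffices H : ∀ m ≤ n,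
      ∫⁻ ω, ENNReal.ofReal (elementarySum W σ ξ m ω ^ (2 * (k + 1))) ∂P
      ≤ ENNReal.ofReal (Real.exp (k * (((σ m : ℝ) - σ 0) / h))) *
        (ENNReal.ofReal (h ^ k) * momentConst k * ∫⁻ ω, ENNReal.ofReal
          (∑ i ∈ Finset.range m, ((σ (i + 1) : ℝ) - σ i) * ξ i ω ^ (2 * (k + 1))) ∂P) by
    refine (H n le_rfl).trans ?_
    rw [ENNReal.ofReal_mul (Real.exp_nonneg _), mul_assoc, mul_assoc, mul_assoc]
    gcongr
    exact mul_le_of_le_one_right (Nat.cast_nonneg k) ((div_le_one hh).2 hlen)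
  intro m
  induction m with
  | zero => intro _; simp [elementarySum]
  | succ m ih =>
    intro hm
    have ih := ih (by omega)
    have hstep : (σ m) ≤ σ (m + 1) := hσ m.le_succ
    have hdh : ((σ (m + 1) - σ m : ℝ≥0) : ℝ) ≤ h := by
      rw [NNReal.coe_sub hstep]
      have h1 : (σ (m + 1) : ℝ) ≤ σ n := NNReal.coe_le_coe.2 (hσ hm)
      have h2 : (σ 0 : ℝ) ≤ σ m := NNReal.coe_le_coe.2 (hσ (Nat.zero_le _))
      linarith
    have hX : Measurable[ℱ (σ m)] fun ω ↦ (elementarySum W σ ξ m ω, ξ m ω) :=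
      (measurable_elementarySum hW hσ hξ m).prodMk (hξ m)
    have hG : Measurable (Function.uncurry fun (p : ℝ × ℝ) (z : ℝ) ↦
        ENNReal.ofReal ((p.1 + p.2 * z) ^ (2 * (k + 1)))) := by
      unfold Function.uncurry; fun_prop
    have hinc := hW.lintegral_increment hstep hX hG
    set S : ℝ≥0∞ := ∫⁻ ω, ENNReal.ofReal
          (∑ i ∈ Finset.range m, ((σ (i + 1) : ℝ) - σ i) * ξ i ω ^ (2 * (k + 1))) ∂P with hS
    have hMm : Measurable (elementarySum W σ ξ m) :=
      (measurable_elementarySum hW hσ hξ m).mono (ℱ.le _) le_rfl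
    have hsum : ∫⁻ ω, ENNReal.ofReal
          (∑ i ∈ Finset.range (m + 1), ((σ (i + 1) : ℝ) - σ i) * ξ i ω ^ (2 * (k + 1))) ∂P
        = S + ∫⁻ ω, ENNReal.ofReal (((σ (m + 1) : ℝ) - σ m) * ξ m ω ^ (2 * (k + 1))) ∂P := by
      rw [hS, ← lintegral_add_right]
      · refine lintegral_congr fun ω ↦ ?_
        rw [Finset.sum_range_succ, ENNReal.ofReal_add]
        · exact Finset.sum_nonneg fun i _ ↦ mul_nonneg (hd0 i) (hpow _)
        · exact mul_nonneg (hd0 m) (hpow _)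
      · have := hξm m; fun_prop
    rw [hsum]
    set J : ℝ≥0∞ :=
      ∫⁻ ω, ENNReal.ofReal (((σ (m + 1) : ℝ) - σ m) * ξ m ω ^ (2 * (k + 1))) ∂P with hJ
    set d : ℝ := (σ (m + 1) : ℝ) - σ m with hd
    have hdd : ((σ (m + 1) - σ m : ℝ≥0) : ℝ) = d := by rw [NNReal.coe_sub hstep]
    have hexp : (1 + d / h) ^ k ≤ Real.exp (k * (d / h)) := by
      rw [Real.exp_nat_mul]
      gcongr
      · have := div_nonneg (hd0 m) hh.le
        linarith
      · linarith [Real.add_one_le_exp (d / h)]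
    have hone : (1 : ℝ≥0∞) ≤ ENNReal.ofReal (Real.exp (k * (((σ (m + 1) : ℝ) - σ 0) / h))) := by
      rw [ENNReal.one_le_ofReal, Real.one_le_exp_iff]
      have : (σ 0 : ℝ) ≤ σ (m + 1) := NNReal.coe_le_coe.2 (hσ (Nat.zero_le _))
      have := div_nonneg (sub_nonneg.2 this) hh.le
      positivity
    calc ∫⁻ ω, ENNReal.ofReal (elementarySum W σ ξ (m + 1) ω ^ (2 * (k + 1))) ∂P
        = ∫⁻ ω, ENNReal.ofReal ((elementarySum W σ ξ m ω +
            ξ m ω * (W (σ (m + 1)) ω - W (σ m) ω)) ^ (2 * (k + 1))) ∂P := by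
          refine lintegral_congr fun ω ↦ ?_
          rw [elementarySum, Finset.sum_range_succ]; rfl
      _ = _ := hinc
      _ ≤ ∫⁻ ω, (ENNReal.ofReal ((1 + d / h) ^ k) *
            ENNReal.ofReal (elementarySum W σ ξ m ω ^ (2 * (k + 1)))
            + momentConst k * ENNReal.ofReal (h ^ k * (d * ξ m ω ^ (2 * (k + 1))))) ∂P := by
          refine lintegral_mono fun ω ↦ ?_
          have := lintegral_gaussianReal_affine_pow_le k hh hdh (elementarySum W σ ξ m ω) (ξ m ω)
          rwa [hdd] at this
      _ = ENNReal.ofReal ((1 + d / h) ^ k) *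
            ∫⁻ ω, ENNReal.ofReal (elementarySum W σ ξ m ω ^ (2 * (k + 1))) ∂P
          + ENNReal.ofReal (h ^ k) * momentConst k * J := by
          have hm2 := hξm m
          rw [lintegral_add_left (by fun_prop), lintegral_const_mul _ (by fun_prop),
            lintegral_const_mul _ (by fun_prop)]
          congr 1
          simp_rw [ENNReal.ofReal_mul (pow_nonneg hh.le k)]
          rw [lintegral_const_mul _ (by fun_prop), hJ]
          ring
      _ ≤ ENNReal.ofReal (Real.exp (k * (d / h))) *
            (ENNReal.ofReal (Real.exp (k * (((σ m : ℝ) - σ 0) / h))) *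
              (ENNReal.ofReal (h ^ k) * momentConst k * S))
          + ENNReal.ofReal (Real.exp (k * (((σ (m + 1) : ℝ) - σ 0) / h))) *
            (ENNReal.ofReal (h ^ k) * momentConst k * J) := by
          exact add_le_add (by gcongr) (le_mul_of_one_le_left zero_le hone)
      _ = _ := by
          rw [← mul_assoc (ENNReal.ofReal (Real.exp (k * (d / h)))),
            ← ENNReal.ofReal_mul (Real.exp_nonneg _), ← Real.exp_add,
            mul_add (ENNReal.ofReal (h ^ k) * momentConst k) S J, mul_add]
          congr 5
          rw [hd]; ring

/-- The second moment of an elementary integral, damped by its quadratic characteristic `A`. In one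
step `A` grows to `A + d`, and `d * exp (-(A + d) / K) ≤ K * (exp (-A / K) - exp (-(A + d) / K))`,
which telescopes. -/
theorem lintegral_elementarySum_sq_exp_le [IsProbabilityMeasure P]
    (hW : IsWienerProcess ℱ W P) (hσ : Monotone σ)
    (hξ : ∀ i, Measurable[ℱ (σ i)] (ξ i)) (n : ℕ) {K : ℝ} (hK : 0 < K) :
    ∫⁻ ω, ENNReal.ofReal (elementarySum W σ ξ n ω ^ 2 *
        Real.exp (-(elementaryQuad σ ξ n ω / K))) ∂P
      ≤ ∫⁻ ω, ENNReal.ofReal (K * (1 - Real.exp (-(elementaryQuad σ ξ n ω / K)))) ∂P := by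
  induction n with
  | zero => simp [elementarySum, elementaryQuad]
  | succ n ih =>
    have hstep : (σ n) ≤ σ (n + 1) := hσ n.le_succ
    have hξm : ∀ i, Measurable (ξ i) := fun i ↦ (hξ i).mono (ℱ.le _) le_rfl
    have hMm : Measurable (elementarySum W σ ξ n) :=
      (measurable_elementarySum hW hσ hξ n).mono (ℱ.le _) le_rfl
    have hQm : ∀ m, Measurable (elementaryQuad σ ξ m) := fun m ↦
      Finset.measurable_fun_sum _ fun i _ ↦ ((hξm i).pow_const 2).mul_const _
    have hd0 : ∀ i, (0 : ℝ) ≤ (σ (i + 1) : ℝ) - σ i := fun i ↦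
      sub_nonneg.2 (NNReal.coe_le_coe.2 (hσ i.le_succ))
    have hQ0 : ∀ m ω, 0 ≤ elementaryQuad σ ξ m ω := fun m ω ↦
      Finset.sum_nonneg fun i _ ↦ mul_nonneg (sq_nonneg _) (hd0 i)
    have hX : Measurable[ℱ (σ n)] fun ω ↦
        ((elementarySum W σ ξ n ω, ξ n ω), elementaryQuad σ ξ (n + 1) ω) :=
      ((measurable_elementarySum hW hσ hξ n).prodMk (hξ n)).prodMk
        (measurable_elementaryQuad_succ hσ hξ n)
    have hG : Measurable (Function.uncurry fun (p : (ℝ × ℝ) × ℝ) (z : ℝ) ↦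
        ENNReal.ofReal ((p.1.1 + p.1.2 * z) ^ 2) * ENNReal.ofReal (Real.exp (-(p.2 / K)))) := by
      unfold Function.uncurry; fun_prop
    have hinc := hW.lintegral_increment hstep hX hG
    set M := elementarySum W σ ξ n with hM
    set A := elementaryQuad σ ξ n with hA
    set A' := elementaryQuad σ ξ (n + 1) with hA'
    have hAA : ∀ ω, A' ω = A ω + ξ n ω ^ 2 * ((σ (n + 1) : ℝ) - σ n) := fun ω ↦ by
      rw [hA', hA, elementaryQuad, Finset.sum_range_succ]; rfl
    have hA0 : ∀ ω, 0 ≤ A ω := hQ0 n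
    have hA0' : ∀ ω, 0 ≤ A' ω := hQ0 (n + 1)
    have hAm : Measurable A := hQm n
    have hAm' : Measurable A' := hQm (n + 1)
    calc ∫⁻ ω, ENNReal.ofReal (elementarySum W σ ξ (n + 1) ω ^ 2 * Real.exp (-(A' ω / K))) ∂P
        = ∫⁻ ω, ENNReal.ofReal ((M ω + ξ n ω * (W (σ (n + 1)) ω - W (σ n) ω)) ^ 2) *
            ENNReal.ofReal (Real.exp (-(A' ω / K))) ∂P := by
          refine lintegral_congr fun ω ↦ ?_
          rw [elementarySum, Finset.sum_range_succ, ENNReal.ofReal_mul (sq_nonneg _)]; rfl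
      _ = _ := hinc
      _ = ∫⁻ ω, ENNReal.ofReal
            ((M ω ^ 2 + (A' ω - A ω)) * Real.exp (-(A' ω / K))) ∂P := by
          refine lintegral_congr fun ω ↦ ?_
          dsimp only
          rw [lintegral_mul_const _ (by fun_prop), lintegral_gaussianReal_affine_sq,
            ← ENNReal.ofReal_mul, hAA ω, NNReal.coe_sub hstep]
          · congr 2; ring
          · positivity
      _ ≤ ∫⁻ ω, (ENNReal.ofReal (M ω ^ 2 * Real.exp (-(A ω / K))) +
            ENNReal.ofReal (K * (Real.exp (-(A ω / K)) - Real.exp (-(A' ω / K))))) ∂P := by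
          refine lintegral_mono fun ω ↦ ?_
          have hle : A ω ≤ A' ω := by
            rw [hAA ω]
            exact le_add_of_nonneg_right (mul_nonneg (sq_nonneg _) (hd0 n))
          have e1 : Real.exp (-(A' ω / K)) ≤ Real.exp (-(A ω / K)) := by gcongr
          have e2 : (A' ω - A ω) * Real.exp (-(A' ω / K)) ≤
              K * (Real.exp (-(A ω / K)) - Real.exp (-(A' ω / K))) := by
            have h1 := Real.add_one_le_exp ((A' ω - A ω) / K)
            have h2 : Real.exp (-(A ω / K))
                = Real.exp ((A' ω - A ω) / K) * Real.exp (-(A' ω / K)) := by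
              rw [← Real.exp_add]; congr 1; ring
            have h3 := mul_le_mul_of_nonneg_right h1 (Real.exp_nonneg (-(A' ω / K)))
            have h4 := mul_le_mul_of_nonneg_left h3 hK.le
            rw [← h2] at h4
            have h5 : K * (((A' ω - A ω) / K + 1) * Real.exp (-(A' ω / K)))
                = (A' ω - A ω) * Real.exp (-(A' ω / K)) + K * Real.exp (-(A' ω / K)) := by
              field_simp
            linarith
          rw [← ENNReal.ofReal_add (by positivity) (mul_nonneg hK.le (by linarith))]
          refine ENNReal.ofReal_le_ofReal ?_
          rw [add_mul]
          have := mul_le_mul_of_nonneg_left e1 (sq_nonneg (M ω))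
          linarith
      _ ≤ ∫⁻ ω, (ENNReal.ofReal (K * (1 - Real.exp (-(A ω / K)))) +
            ENNReal.ofReal (K * (Real.exp (-(A ω / K)) - Real.exp (-(A' ω / K))))) ∂P := by
          rw [lintegral_add_left (by fun_prop), lintegral_add_left (by fun_prop)]
          gcongr
      _ = _ := by
          refine lintegral_congr fun ω ↦ ?_
          have hle : A ω ≤ A' ω := by
            rw [hAA ω]
            exact le_add_of_nonneg_right (mul_nonneg (sq_nonneg _) (hd0 n))
          have e1 : Real.exp (-(A' ω / K)) ≤ Real.exp (-(A ω / K)) := by gcongr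
          have e3 : Real.exp (-(A ω / K)) ≤ 1 := by
            rw [Real.exp_le_one_iff]
            have := hA0 ω
            have : 0 ≤ A ω / K := by positivity
            linarith
          rw [← ENNReal.ofReal_add (mul_nonneg hK.le (by linarith))
            (mul_nonneg hK.le (by linarith))]
          congr 1; ring

end Increments

/-! ### Truncation and simple processes -/

/-- Truncation of a real number to the interval `[-c, c]`. -/
noncomputable def clip (c x : ℝ) : ℝ := max (-c) (min c x)

theorem abs_clip_le {c : ℝ} (hc : 0 ≤ c) (x : ℝ) : |clip c x| ≤ c := by
  unfold clip
  exact abs_le.2 ⟨le_max_left _ _, max_le (by linarith) (min_le_left _ _)⟩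

theorem measurable_clip (c : ℝ) : Measurable (clip c) :=
  measurable_const.max (measurable_const.min measurable_id)

theorem clip_of_abs_le {c x : ℝ} (h : |x| ≤ c) : clip c x = x := by
  rw [abs_le] at h
  rw [clip, min_eq_right h.2, max_eq_right h.1]

theorem abs_clip_le_abs {c : ℝ} (hc : 0 ≤ c) (x : ℝ) : |clip c x| ≤ |x| := by
  rcases le_total |x| c with h | h
  · rw [clip_of_abs_le h]
  · exact (abs_clip_le hc x).trans h

theorem abs_sub_clip_le {c : ℝ} (hc : 0 ≤ c) (x : ℝ) : |x - clip c x| ≤ |x| := by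
  unfold clip
  rcases max_cases (-c) (min c x) with h | h <;> rcases min_cases c x with h' | h' <;>
    rcases abs_cases x with h3 | h3 <;> rw [abs_le] <;> constructor <;> linarith

theorem abs_clip_sub_clip_le (c x y : ℝ) : |clip c x - clip c y| ≤ |x - y| := by
  unfold clip
  refine (abs_max_sub_max_le_max _ _ _ _).trans ?_
  rw [sub_self, abs_zero]
  refine max_le (abs_nonneg _) ((abs_min_sub_min_le_max _ _ _ _).trans ?_)
  rw [sub_self, abs_zero]
  exact max_le (abs_nonneg _) le_rfl

theorem abs_sub_clip_sub_le (c x y : ℝ) :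
    |(x - clip c x) - (y - clip c y)| ≤ |x - y| := by
  wlog hxy : y ≤ x generalizing x y
  · rw [abs_sub_comm, abs_sub_comm x]
    exact this y x (le_of_not_ge hxy)
  have h1 := abs_clip_sub_clip_le c x y
  have h2 : clip c y ≤ clip c x := max_le_max le_rfl (min_le_min le_rfl hxy)
  rw [abs_of_nonneg (sub_nonneg.2 h2), abs_of_nonneg (sub_nonneg.2 hxy)] at h1
  rw [abs_of_nonneg (sub_nonneg.2 hxy), abs_of_nonneg] <;> linarith

section Tail

variable {Ω : Type*} {mΩ : MeasurableSpace Ω} {P : Measure Ω}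
  {ℱ : Filtration ℝ≥0 mΩ} {W : ℝ≥0 → Ω → ℝ} {σ : ℕ → ℝ≥0} {ξ : ℕ → Ω → ℝ}

theorem measure_le_abs_elementarySum_pow [IsProbabilityMeasure P] (hW : IsWienerProcess ℱ W P)
    (hσ : Monotone σ) (hξ : ∀ i, Measurable[ℱ (σ i)] (ξ i)) (k n : ℕ) {h : ℝ} (hh : 0 < h)
    (hlen : (σ n : ℝ) - σ 0 ≤ h) {ε : ℝ} (hε : 0 < ε) :
    P {ω | ε ≤ |elementarySum W σ ξ n ω|} ≤
      ENNReal.ofReal (Real.exp k) * momentConst k * ENNReal.ofReal (h ^ k / ε ^ (2 * (k + 1))) *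
        ∫⁻ ω, ENNReal.ofReal
          (∑ i ∈ Finset.range n, ((σ (i + 1) : ℝ) - σ i) * ξ i ω ^ (2 * (k + 1))) ∂P := by
  have hMm : Measurable (elementarySum W σ ξ n) :=
      (measurable_elementarySum hW hσ hξ n).mono (ℱ.le _) le_rfl
  have h1 := lintegral_elementarySum_pow_le hW hσ hξ k n hh hlen
  have h2 := meas_ge_le_lintegral_div (μ := P)
    (f := fun ω ↦ ENNReal.ofReal (elementarySum W σ ξ n ω ^ (2 * (k + 1))))
    (by fun_prop) (ε := ENNReal.ofReal (ε ^ (2 * (k + 1)))) (by simp; positivity) (by simp)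
  have hsub : {ω | ε ≤ |elementarySum W σ ξ n ω|} ⊆ {ω | ENNReal.ofReal (ε ^ (2 * (k + 1))) ≤
      ENNReal.ofReal (elementarySum W σ ξ n ω ^ (2 * (k + 1)))} := by
    intro ω hω
    refine ENNReal.ofReal_le_ofReal ?_
    rw [pow_mul _ 2, pow_mul _ 2, ← sq_abs (elementarySum W σ ξ n ω)]
    have : ε ≤ |elementarySum W σ ξ n ω| := hω
    gcongr
  refine (measure_mono hsub).trans (h2.trans ((ENNReal.div_le_div_right h1 _).trans (le_of_eq ?_)))
  rw [ENNReal.ofReal_div_of_pos (by positivity), ENNReal.ofReal_mul (Real.exp_nonneg _)]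
  simp only [div_eq_mul_inv]
  ring

/-- A Lenglart inequality: Markov applied to `lintegral_elementarySum_sq_exp_le`. -/
theorem measure_le_abs_elementarySum_inter [IsProbabilityMeasure P] (hW : IsWienerProcess ℱ W P)
    (hσ : Monotone σ) (hξ : ∀ i, Measurable[ℱ (σ i)] (ξ i)) (n : ℕ) {K : ℝ} (hK : 0 < K)
    {ε : ℝ} (hε : 0 < ε) :
    P {ω | ε ≤ |elementarySum W σ ξ n ω| ∧ elementaryQuad σ ξ n ω ≤ K} ≤
      ENNReal.ofReal (Real.exp 1) * ENNReal.ofReal (1 / ε ^ 2) *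
        ∫⁻ ω, ENNReal.ofReal (min (elementaryQuad σ ξ n ω) K) ∂P := by
  have hMm : Measurable (elementarySum W σ ξ n) :=
      (measurable_elementarySum hW hσ hξ n).mono (ℱ.le _) le_rfl
  have hξm : ∀ i, Measurable (ξ i) := fun i ↦ (hξ i).mono (ℱ.le _) le_rfl
  have hQm : Measurable (elementaryQuad σ ξ n) :=
    Finset.measurable_fun_sum _ fun i _ ↦ ((hξm i).pow_const 2).mul_const _
  have hQ0 : ∀ ω, 0 ≤ elementaryQuad σ ξ n ω := fun ω ↦
    Finset.sum_nonneg fun i _ ↦ mul_nonneg (sq_nonneg _)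
      (sub_nonneg.2 (NNReal.coe_le_coe.2 (hσ i.le_succ)))
  have h1 := lintegral_elementarySum_sq_exp_le hW hσ hξ n hK
  have h2 := meas_ge_le_lintegral_div (μ := P)
    (f := fun ω ↦ ENNReal.ofReal (elementarySum W σ ξ n ω ^ 2 *
        Real.exp (-(elementaryQuad σ ξ n ω / K))))
    (by fun_prop) (ε := ENNReal.ofReal (ε ^ 2 * Real.exp (-1)))
    (by simp only [ne_eq, ENNReal.ofReal_eq_zero, not_le]; positivity) (by simp)
  have hsub : {ω | ε ≤ |elementarySum W σ ξ n ω| ∧ elementaryQuad σ ξ n ω ≤ K} ⊆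
      {ω | ENNReal.ofReal (ε ^ 2 * Real.exp (-1)) ≤
      ENNReal.ofReal (elementarySum W σ ξ n ω ^ 2 *
        Real.exp (-(elementaryQuad σ ξ n ω / K)))} := by
    rintro ω ⟨hω, hω2⟩
    refine ENNReal.ofReal_le_ofReal ?_
    rw [← sq_abs (elementarySum W σ ξ n ω)]
    have : elementaryQuad σ ξ n ω / K ≤ 1 := (div_le_one hK).2 hω2
    gcongr
  have h3 : ∫⁻ ω, ENNReal.ofReal (K * (1 - Real.exp (-(elementaryQuad σ ξ n ω / K)))) ∂P
      ≤ ∫⁻ ω, ENNReal.ofReal (min (elementaryQuad σ ξ n ω) K) ∂P := by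
    refine lintegral_mono fun ω ↦ ENNReal.ofReal_le_ofReal (le_min ?_ ?_)
    · have := Real.add_one_le_exp (-(elementaryQuad σ ξ n ω / K))
      calc _ ≤ K * (elementaryQuad σ ξ n ω / K) := by gcongr; linarith
        _ = _ := by field_simp
    · have := Real.exp_nonneg (-(elementaryQuad σ ξ n ω / K))
      nlinarith
  refine (measure_mono hsub).trans
    (h2.trans ((ENNReal.div_le_div_right (h1.trans h3) _).trans (le_of_eq ?_)))
  rw [ENNReal.div_eq_inv_mul, ← ENNReal.ofReal_inv_of_pos (by positivity),
    ← ENNReal.ofReal_mul (Real.exp_nonneg _)]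
  congr 2
  rw [Real.exp_neg]
  field_simp

/-- The basic estimate: the integrand is split into its truncation at `c` and the excess, and the
two parts are treated with `measure_le_abs_elementarySum_pow` and
`measure_le_abs_elementarySum_inter`. -/
theorem measure_le_abs_elementarySum_clip [IsProbabilityMeasure P] (hW : IsWienerProcess ℱ W P)
    (hσ : Monotone σ) (hξ : ∀ i, Measurable[ℱ (σ i)] (ξ i)) (k n : ℕ) {h : ℝ} (hh : 0 < h)
    (hlen : (σ n : ℝ) - σ 0 ≤ h) {K : ℝ} (hK : 0 < K) {ε : ℝ} (hε : 0 < ε) (c : ℝ) :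
    P {ω | 2 * ε ≤ |elementarySum W σ ξ n ω| ∧
        elementaryQuad σ (fun i ω ↦ ξ i ω - clip c (ξ i ω)) n ω ≤ K} ≤
      ENNReal.ofReal (Real.exp k) * momentConst k * ENNReal.ofReal (h ^ k / ε ^ (2 * (k + 1))) *
        ∫⁻ ω, ENNReal.ofReal
          (∑ i ∈ Finset.range n, ((σ (i + 1) : ℝ) - σ i) * clip c (ξ i ω) ^ (2 * (k + 1))) ∂P +
      ENNReal.ofReal (Real.exp 1) * ENNReal.ofReal (1 / ε ^ 2) *
        ∫⁻ ω, ENNReal.ofReal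
          (min (elementaryQuad σ (fun i ω ↦ ξ i ω - clip c (ξ i ω)) n ω) K) ∂P := by
  have hc : ∀ i, Measurable[ℱ (σ i)] fun ω ↦ clip c (ξ i ω) := fun i ↦
    (measurable_clip c).comp (hξ i)
  have h1 := measure_le_abs_elementarySum_pow hW hσ hc k n hh hlen hε
  have h2 := measure_le_abs_elementarySum_inter hW hσ (fun i ↦ (hξ i).sub (hc i)) n hK hε
  refine le_trans (measure_mono ?_) ((measure_union_le _ _).trans (add_le_add h1 h2))
  rintro ω ⟨hω1, hω2⟩
  by_contra hcon
  simp only [Set.mem_union, Set.mem_ofPred_eq, not_or, not_and, not_le] at hcon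
  have e : elementarySum W σ ξ n ω = elementarySum W σ (fun i ω ↦ clip c (ξ i ω)) n ω
      + elementarySum W σ (fun i ω ↦ ξ i ω - clip c (ξ i ω)) n ω := by
    simp only [elementarySum, ← Finset.sum_add_distrib]
    exact Finset.sum_congr rfl fun i _ ↦ by ring
  have h4 : |elementarySum W σ (fun i ω ↦ ξ i ω - clip c (ξ i ω)) n ω| < ε :=
    not_le.1 fun h ↦ absurd hω2 (not_le.2 (hcon.2 h))
  have := abs_add_le (elementarySum W σ (fun i ω ↦ clip c (ξ i ω)) n ω)
    (elementarySum W σ (fun i ω ↦ ξ i ω - clip c (ξ i ω)) n ω)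
  rw [← e] at this
  linarith [hcon.1]

end Tail

namespace SimpleProcess

variable {Ω : Type*} {mΩ : MeasurableSpace Ω} {ℱ : Filtration ℝ≥0 mΩ}

/-- The partition points of a simple process, moved to the nearest point of `[s, t]`. -/
noncomputable def clampTime (V : SimpleProcess ℱ) (s t : ℝ≥0) (i : ℕ) : ℝ≥0 :=
  max s (min (V.τ i) t)

/-- The values of a simple process, with those that are taken after time `t` replaced by zero.
Without this replacement the value would not be measurable at the clamped time, which is `t`. -/
noncomputable def valueUpTo (V : SimpleProcess ℱ) (t : ℝ≥0) (i : ℕ) (ω : Ω) : ℝ :=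
  if V.τ i ≤ t then V.ξ i ω else 0

theorem monotone_clampTime (V : SimpleProcess ℱ) (s t : ℝ≥0) : Monotone (V.clampTime s t) :=
  fun _ _ h ↦ max_le_max le_rfl (min_le_min (V.mono h) le_rfl)

theorem measurable_valueUpTo (V : SimpleProcess ℱ) (s t : ℝ≥0) (i : ℕ) :
    Measurable[ℱ (V.clampTime s t i)] (V.valueUpTo t i) := by
  unfold valueUpTo
  by_cases h : V.τ i ≤ t
  · simp only [h, if_true]
    refine (V.measurable i).mono (ℱ.mono ?_) le_rfl
    rw [clampTime, min_eq_left h]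
    exact le_max_right _ _
  · simp only [h, if_false]
    exact measurable_const

/-- The increment over `[s, t]` of the integral of a simple process is again an elementary integral,
over the partition clamped to `[s, t]`. -/
theorem integral_sub_integral (V : SimpleProcess ℱ) (W : ℝ≥0 → Ω → ℝ) {s t : ℝ≥0} (hst : s ≤ t)
    (ω : Ω) : V.integral W t ω - V.integral W s ω
      = elementarySum W (V.clampTime s t) (V.valueUpTo t) V.n ω := by
  -- `max s (min x t)` is `x` clamped to `[s, t]`
  have key : ∀ x : ℝ≥0, W (min x t) ω - W (min x s) ω = W (max s (min x t)) ω - W s ω := by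
    intro x
    rcases le_total x s with h | h
    · rw [min_eq_left (h.trans hst), min_eq_left h, max_eq_left h]; ring
    · rw [min_eq_right h, max_eq_right (le_min h hst)]
  unfold SimpleProcess.integral elementarySum
  rw [← Finset.sum_sub_distrib]
  refine Finset.sum_congr rfl fun i _ ↦ ?_
  have h1 := key (V.τ i)
  have h2 := key (V.τ (i + 1))
  by_cases h : V.τ i ≤ t
  · rw [valueUpTo, if_pos h, clampTime, clampTime]
    linear_combination V.ξ i ω * (h2 - h1)
  · have h' : t ≤ V.τ i := le_of_not_ge h
    have h'' : t ≤ V.τ (i + 1) := h'.trans (V.mono i.le_succ)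
    rw [valueUpTo, if_neg h, min_eq_right h', min_eq_right h'', min_eq_right (hst.trans h'),
      min_eq_right (hst.trans h'')]
    ring

theorem eval_of_mem (V : SimpleProcess ℱ) {i : ℕ} (hi : i < V.n) {u : ℝ≥0}
    (hu : u ∈ Set.Ioc (V.τ i) (V.τ (i + 1))) (ω : Ω) : V.eval u ω = V.ξ i ω := by
  unfold eval
  rw [Finset.sum_eq_single i]
  · rw [Set.indicator_of_mem hu]
  · intro j _ hji
    rw [Set.indicator_of_notMem]
    rintro ⟨h1, h2⟩
    rcases lt_or_gt_of_ne hji with h | h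
    · exact absurd (h2.trans (V.mono (Nat.succ_le_of_lt h))) (not_le.2 hu.1)
    · exact absurd (hu.2.trans (V.mono (Nat.succ_le_of_lt h))) (not_le.2 h1)
  · intro h
    exact absurd (Finset.mem_range.2 hi) h

theorem sum_le_setLIntegral_eval (V : SimpleProcess ℱ) (s t : ℝ≥0) (ω : Ω)
    (g : ℝ → ℝ≥0∞) :
    ∑ i ∈ Finset.range V.n,
        ENNReal.ofReal ((V.clampTime s t (i + 1) : ℝ) - V.clampTime s t i) * g (V.valueUpTo t i ω)
      ≤ ∫⁻ u in Set.Icc (s : ℝ) t, g (V.eval u.toNNReal ω) := by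
  have hmem : ∀ i ∈ Finset.range V.n,
      ∀ u ∈ Set.Ioc (V.clampTime s t i : ℝ) (V.clampTime s t (i + 1)),
      u ∈ Set.Icc (s : ℝ) t ∧ V.valueUpTo t i ω = V.eval u.toNNReal ω := by
    intro i hi u hu
    have hu0 : 0 ≤ u := (NNReal.coe_nonneg _).trans hu.1.le
    lift u to ℝ≥0 using hu0
    simp only [Set.mem_Ioc, NNReal.coe_lt_coe, NNReal.coe_le_coe, clampTime, max_lt_iff,
      le_max_iff, le_min_iff] at hu
    obtain ⟨⟨h1, h2⟩, h3⟩ := hu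
    have h4 : u ≤ V.τ (i + 1) ∧ u ≤ t := h3.resolve_left (not_le.2 h1)
    have h5 : V.τ i < u := by
      rcases min_lt_iff.1 h2 with h | h
      · exact h
      · exact absurd h4.2 (not_le.2 h)
    refine ⟨⟨NNReal.coe_le_coe.2 h1.le, NNReal.coe_le_coe.2 h4.2⟩, ?_⟩
    rw [Real.toNNReal_coe, V.eval_of_mem (Finset.mem_range.1 hi) ⟨h5, h4.1⟩, valueUpTo,
      if_pos (h5.le.trans h4.2)]
  have hdisj : Set.PairwiseDisjoint (↑(Finset.range V.n) : Set ℕ)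
      fun i ↦ Set.Ioc (V.clampTime s t i : ℝ) (V.clampTime s t (i + 1)) :=
    fun i _ j _ hij ↦ (Monotone.pairwise_disjoint_on_Ioc_succ
      (f := fun i ↦ (V.clampTime s t i : ℝ)) fun a b h ↦
        NNReal.coe_le_coe.2 (V.monotone_clampTime s t h)) hij
  calc _ = ∑ i ∈ Finset.range V.n, ∫⁻ u in Set.Ioc (V.clampTime s t i : ℝ)
        (V.clampTime s t (i + 1)), g (V.eval u.toNNReal ω) := by
        refine Finset.sum_congr rfl fun i hi ↦ ?_
        rw [setLIntegral_congr_fun measurableSet_Ioc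
          (fun u hu ↦ congrArg g (hmem i hi u hu).2.symm), setLIntegral_const, Real.volume_Ioc,
          mul_comm]
    _ = ∫⁻ u in ⋃ i ∈ Finset.range V.n, Set.Ioc (V.clampTime s t i : ℝ)
        (V.clampTime s t (i + 1)), g (V.eval u.toNNReal ω) :=
        (lintegral_biUnion_finset hdisj (fun _ _ ↦ measurableSet_Ioc) _).symm
    _ ≤ _ := lintegral_mono_set (Set.iUnion₂_subset fun i hi u hu ↦ (hmem i hi u hu).1)

end SimpleProcess

/-! ### Increments of the Itô integral -/

section Limit

variable {Ω : Type*} {mΩ : MeasurableSpace Ω} {P : Measure Ω}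

theorem tendsto_lintegral_min_of_tendsto_measure [IsFiniteMeasure P] {R : ℕ → Ω → ℝ≥0∞}
    (hR : ∀ ε : ℝ≥0∞, 0 < ε → Tendsto (fun j ↦ P {ω | ε ≤ R j ω}) atTop (𝓝 0))
    {a b : ℝ≥0∞} (ha : a ≠ ∞) (hb : b ≠ ∞) :
    Tendsto (fun j ↦ ∫⁻ ω, min (a * R j ω) b ∂P) atTop (𝓝 0) := by
  have hbound : ∀ δ : ℝ≥0∞, 0 < δ → ∀ j, ∫⁻ ω, min (a * R j ω) b ∂P ≤
      a * δ * P Set.univ + b * P {ω | δ ≤ R j ω} := by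
    intro δ _ j
    calc ∫⁻ ω, min (a * R j ω) b ∂P
        ≤ ∫⁻ ω, (a * δ + {ω | δ ≤ R j ω}.indicator (fun _ ↦ b) ω) ∂P := by
          refine lintegral_mono fun ω ↦ ?_
          by_cases h : δ ≤ R j ω
          · rw [Set.indicator_of_mem (show ω ∈ {ω | δ ≤ R j ω} from h)]
            exact (min_le_right _ _).trans le_add_self
          · rw [Set.indicator_of_notMem (show ω ∉ {ω | δ ≤ R j ω} from h), add_zero]
            exact (min_le_left _ _).trans (by gcongr; exact (not_le.1 h).le)
      _ ≤ _ := by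
          rw [lintegral_add_left measurable_const, lintegral_const]
          gcongr
          exact lintegral_indicator_const_le _ _
  have hlim : ∀ δ : ℝ≥0∞, 0 < δ →
      limsup (fun j ↦ ∫⁻ ω, min (a * R j ω) b ∂P) atTop ≤ a * δ * P Set.univ := by
    intro δ hδ
    have h1 : Tendsto (fun j ↦ a * δ * P Set.univ + b * P {ω | δ ≤ R j ω}) atTop
        (𝓝 (a * δ * P Set.univ + b * 0)) :=
      tendsto_const_nhds.add (ENNReal.Tendsto.const_mul (hR δ hδ) (Or.inr hb))
    rw [mul_zero, add_zero] at h1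
    exact (limsup_le_limsup (Eventually.of_forall (hbound δ hδ))).trans h1.limsup_eq.le
  refine tendsto_of_le_liminf_of_limsup_le zero_le ?_
  have h2 : Tendsto (fun δ : ℝ≥0∞ ↦ a * δ * P Set.univ) (𝓝[>] 0) (𝓝 (a * 0 * P Set.univ)) := by
    refine Tendsto.mono_left ?_ nhdsWithin_le_nhds
    exact ENNReal.Tendsto.mul_const (ENNReal.Tendsto.const_mul tendsto_id (Or.inr ha))
      (Or.inr (measure_ne_top _ _))
  rw [mul_zero, zero_mul] at h2
  exact ge_of_tendsto h2 (eventually_mem_nhdsWithin.mono fun δ hδ ↦ hlim δ hδ)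

variable {ℱ : Filtration ℝ≥0 mΩ} {W : ℝ≥0 → Ω → ℝ}

/-- The elementary estimate of `measure_le_abs_elementarySum_clip` for an increment of the integral
of a simple process `V`, in terms of a process `θ` that `V` approximates. -/
theorem SimpleProcess.measure_increment_le [IsProbabilityMeasure P] (hW : IsWienerProcess ℱ W P)
    (V : SimpleProcess ℱ) {θ : ℝ → Ω → ℝ} (hθ : Measurable (Function.uncurry θ)) (k : ℕ)
    {T s t : ℝ≥0} (hst : s < t) (htT : t ≤ T) {c ε K : ℝ} (hc : 0 < c) (hε : 0 < ε) (hK : 0 < K) :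
    P {ω | 2 * ε ≤ |V.integral W t ω - V.integral W s ω| ∧
        (∫⁻ u in Set.Icc (s : ℝ) t, ENNReal.ofReal ((θ u ω - clip c (θ u ω)) ^ 2))
          ≤ ENNReal.ofReal K ∧
        (∫⁻ u in Set.Icc (0 : ℝ) T, ‖V.eval u.toNNReal ω - θ u ω‖ₑ ^ 2) ≤ ENNReal.ofReal K} ≤
      ENNReal.ofReal (Real.exp k) * momentConst k *
          ENNReal.ofReal (((t : ℝ) - s) ^ k / ε ^ (2 * (k + 1))) *
        (ENNReal.ofReal (4 ^ (k + 1)) * ∫⁻ ω, (∫⁻ u in Set.Icc (s : ℝ) t,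
            ENNReal.ofReal (clip c (θ u ω) ^ (2 * (k + 1)))) ∂P +
          ∫⁻ ω, min (ENNReal.ofReal (4 ^ (k + 1) * (2 * c) ^ (2 * k)) *
            ∫⁻ u in Set.Icc (0 : ℝ) T, ‖V.eval u.toNNReal ω - θ u ω‖ₑ ^ 2)
              (ENNReal.ofReal (((t : ℝ) - s) * c ^ (2 * (k + 1)))) ∂P) +
      ENNReal.ofReal (Real.exp 1) * ENNReal.ofReal (1 / ε ^ 2) *
        (4 * ∫⁻ ω, min (∫⁻ u in Set.Icc (s : ℝ) t,
            ENNReal.ofReal ((θ u ω - clip c (θ u ω)) ^ 2)) (ENNReal.ofReal K) ∂P +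
          ∫⁻ ω, min (2 * ∫⁻ u in Set.Icc (0 : ℝ) T, ‖V.eval u.toNNReal ω - θ u ω‖ₑ ^ 2)
            (4 * ENNReal.ofReal K) ∂P) := by
  set R : Ω → ℝ≥0∞ := fun ω ↦
    ∫⁻ u in Set.Icc (0 : ℝ) T, ‖V.eval u.toNNReal ω - θ u ω‖ₑ ^ 2 with hR
  set L : Ω → ℝ≥0∞ := fun ω ↦
    ∫⁻ u in Set.Icc (s : ℝ) t, ENNReal.ofReal ((θ u ω - clip c (θ u ω)) ^ 2) with hL
  set S : Ω → ℝ≥0∞ := fun ω ↦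
    ∫⁻ u in Set.Icc (s : ℝ) t, ENNReal.ofReal (clip c (θ u ω) ^ (2 * (k + 1))) with hS
  have hcl := measurable_clip c
  have hS_meas : Measurable S := by
    refine Measurable.lintegral_prod_left' (f := fun p : ℝ × Ω ↦
      ENNReal.ofReal (clip c (θ p.1 p.2) ^ (2 * (k + 1)))) ?_
    exact ((hcl.comp hθ).pow_const _).ennreal_ofReal
  have hL_meas : Measurable L := by
    refine Measurable.lintegral_prod_left' (f := fun p : ℝ × Ω ↦
      ENNReal.ofReal ((θ p.1 p.2 - clip c (θ p.1 p.2)) ^ 2)) ?_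
    exact ((hθ.sub (hcl.comp hθ)).pow_const _).ennreal_ofReal
  have hθω : ∀ ω, Measurable fun u ↦ θ u ω := fun ω ↦
    hθ.comp (measurable_id.prodMk measurable_const)
  have hh : (0 : ℝ) < (t : ℝ) - s := sub_pos.2 (NNReal.coe_lt_coe.2 hst)
  set σ := V.clampTime s t with hσ
  set ξ := V.valueUpTo t with hξ
  have hd0 : ∀ i, (0 : ℝ) ≤ (σ (i + 1) : ℝ) - σ i := fun i ↦
    sub_nonneg.2 (NNReal.coe_le_coe.2 (V.monotone_clampTime s t i.le_succ))
  have hrange : ∀ i, (s : ℝ) ≤ σ i ∧ (σ i : ℝ) ≤ t := fun i ↦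
    ⟨NNReal.coe_le_coe.2 (le_max_left _ _),
      NNReal.coe_le_coe.2 (max_le hst.le (min_le_right _ _))⟩
  have hlen : (σ V.n : ℝ) - σ 0 ≤ (t : ℝ) - s := by
    linarith [(hrange V.n).2, (hrange 0).1]
  have hR_le : ∀ ω, (∫⁻ u in Set.Icc (s : ℝ) t, ‖V.eval u.toNNReal ω - θ u ω‖ₑ ^ 2) ≤ R ω :=
    fun ω ↦ lintegral_mono_set (Set.Icc_subset_Icc s.coe_nonneg (NNReal.coe_le_coe.2 htT))
  have hen : ∀ x : ℝ, ‖x‖ₑ ^ 2 = ENNReal.ofReal (x ^ 2) := fun x ↦ by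
    rw [← ofReal_norm, ← ENNReal.ofReal_pow (norm_nonneg _), Real.norm_eq_abs, sq_abs]
  -- the part of the quadratic characteristic above the truncation level
  have hA : ∀ ω, ENNReal.ofReal (elementaryQuad σ (fun i ω ↦ ξ i ω - clip c (ξ i ω)) V.n ω) ≤
      2 * L ω + 2 * R ω := by
    intro ω
    calc _ = ∑ i ∈ Finset.range V.n, ENNReal.ofReal ((σ (i + 1) : ℝ) - σ i) *
          ENNReal.ofReal ((ξ i ω - clip c (ξ i ω)) ^ 2) := by
          rw [elementaryQuad, ENNReal.ofReal_sum_of_nonneg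
            fun i _ ↦ mul_nonneg (sq_nonneg _) (hd0 i)]
          refine Finset.sum_congr rfl fun i _ ↦ ?_
          rw [mul_comm, ENNReal.ofReal_mul (hd0 i)]
      _ ≤ ∫⁻ u in Set.Icc (s : ℝ) t, ENNReal.ofReal
            ((V.eval u.toNNReal ω - clip c (V.eval u.toNNReal ω)) ^ 2) :=
          V.sum_le_setLIntegral_eval s t ω fun x ↦ ENNReal.ofReal ((x - clip c x) ^ 2)
      _ ≤ ∫⁻ u in Set.Icc (s : ℝ) t, (2 * ENNReal.ofReal ((θ u ω - clip c (θ u ω)) ^ 2) +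
            2 * ‖V.eval u.toNNReal ω - θ u ω‖ₑ ^ 2) := by
          refine lintegral_mono fun u ↦ ?_
          dsimp only
          rw [hen, ← ENNReal.ofReal_ofNat 2, ← ENNReal.ofReal_mul (by norm_num),
            ← ENNReal.ofReal_mul (by norm_num), ← ENNReal.ofReal_add (by positivity)
            (by positivity)]
          refine ENNReal.ofReal_le_ofReal ?_
          have h := sq_le_sq.2 (abs_sub_clip_sub_le c (V.eval u.toNNReal ω) (θ u ω))
          nlinarith [sq_nonneg (2 * (θ u ω - clip c (θ u ω)) -
            (V.eval u.toNNReal ω - clip c (V.eval u.toNNReal ω)))]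
      _ ≤ 2 * L ω + 2 * R ω := by
          have hm : Measurable fun u ↦ 2 * ENNReal.ofReal ((θ u ω - clip c (θ u ω)) ^ 2) :=
            (((hθω ω).sub (hcl.comp (hθω ω))).pow_const _).ennreal_ofReal.const_mul _
          rw [lintegral_add_left hm, lintegral_const_mul' _ _ (by simp),
            lintegral_const_mul' _ _ (by simp)]
          gcongr
          exact hR_le ω
  -- the part below the truncation level
  have hB : ∀ ω, ENNReal.ofReal
      (∑ i ∈ Finset.range V.n, ((σ (i + 1) : ℝ) - σ i) * clip c (ξ i ω) ^ (2 * (k + 1))) ≤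
      ENNReal.ofReal (4 ^ (k + 1)) * S ω +
        min (ENNReal.ofReal (4 ^ (k + 1) * (2 * c) ^ (2 * k)) * R ω)
          (ENNReal.ofReal (((t : ℝ) - s) * c ^ (2 * (k + 1)))) := by
    intro ω
    have hp : ∀ x : ℝ, 0 ≤ x ^ (2 * (k + 1)) := fun x ↦ by rw [pow_mul]; positivity
    have hp' : ∀ x : ℝ, x ^ (2 * (k + 1)) = |x| ^ (2 * (k + 1)) := fun x ↦ by
      rw [pow_mul, pow_mul, sq_abs]
    rw [← min_add_add_left]
    refine le_min ?_ (le_trans ?_ le_add_self)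
    · calc _ = ∑ i ∈ Finset.range V.n, ENNReal.ofReal ((σ (i + 1) : ℝ) - σ i) *
            ENNReal.ofReal (clip c (ξ i ω) ^ (2 * (k + 1))) := by
            rw [ENNReal.ofReal_sum_of_nonneg fun i _ ↦ mul_nonneg (hd0 i) (hp _)]
            exact Finset.sum_congr rfl fun i _ ↦ ENNReal.ofReal_mul (hd0 i)
        _ ≤ ∫⁻ u in Set.Icc (s : ℝ) t, ENNReal.ofReal
              (clip c (V.eval u.toNNReal ω) ^ (2 * (k + 1))) :=
            V.sum_le_setLIntegral_eval s t ω fun x ↦ ENNReal.ofReal (clip c x ^ (2 * (k + 1)))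
        _ ≤ ∫⁻ u in Set.Icc (s : ℝ) t, (ENNReal.ofReal (4 ^ (k + 1)) *
              ENNReal.ofReal (clip c (θ u ω) ^ (2 * (k + 1))) +
              ENNReal.ofReal (4 ^ (k + 1) * (2 * c) ^ (2 * k)) *
                ‖V.eval u.toNNReal ω - θ u ω‖ₑ ^ 2) := by
            refine lintegral_mono fun u ↦ ?_
            dsimp only
            rw [hen, ← ENNReal.ofReal_mul (by positivity), ← ENNReal.ofReal_mul (by positivity),
              ← ENNReal.ofReal_add (mul_nonneg (by positivity) (hp _)) (by positivity)]
            refine ENNReal.ofReal_le_ofReal ?_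
            set a := clip c (V.eval u.toNNReal ω)
            set b := clip c (θ u ω)
            have ha : |a| ≤ c := abs_clip_le hc.le _
            have hb : |b| ≤ c := abs_clip_le hc.le _
            have hab : |a - b| ≤ |V.eval u.toNNReal ω - θ u ω| := abs_clip_sub_clip_le _ _ _
            have h2c : |a - b| ≤ 2 * c := (abs_sub a b).trans (by linarith)
            have h1 : (a - b) ^ (2 * (k + 1)) ≤
                (2 * c) ^ (2 * k) * (V.eval u.toNNReal ω - θ u ω) ^ 2 := by
              rw [hp', show 2 * (k + 1) = 2 * k + 2 by ring, pow_add,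
                ← sq_abs (V.eval u.toNNReal ω - θ u ω)]
              gcongr
            have h3 : a ^ 2 ≤ 4 * max (b ^ 2) ((a - b) ^ 2) := by
              rcases max_cases (b ^ 2) ((a - b) ^ 2) with ⟨h, h'⟩ | ⟨h, h'⟩ <;> rw [h] <;>
                nlinarith [sq_nonneg (a - 2 * b)]
            have h4 : a ^ (2 * (k + 1)) ≤
                4 ^ (k + 1) * (b ^ (2 * (k + 1)) + (a - b) ^ (2 * (k + 1))) := by
              calc a ^ (2 * (k + 1)) = (a ^ 2) ^ (k + 1) := pow_mul _ _ _
                _ ≤ (4 * max (b ^ 2) ((a - b) ^ 2)) ^ (k + 1) := by gcongr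
                _ = 4 ^ (k + 1) * (max (b ^ 2) ((a - b) ^ 2)) ^ (k + 1) := mul_pow _ _ _
                _ ≤ _ := by
                  gcongr
                  rcases max_choice (b ^ 2) ((a - b) ^ 2) with h | h <;>
                    rw [h, ← pow_mul] <;> linarith [hp b, hp (a - b)]
            have h5 : (0 : ℝ) ≤ 4 ^ (k + 1) := by positivity
            nlinarith [mul_le_mul_of_nonneg_left h1 h5]
        _ ≤ _ := by
            have hm : Measurable fun u ↦ ENNReal.ofReal (4 ^ (k + 1)) *
                ENNReal.ofReal (clip c (θ u ω) ^ (2 * (k + 1))) :=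
              ((hcl.comp (hθω ω)).pow_const _).ennreal_ofReal.const_mul _
            rw [lintegral_add_left hm, lintegral_const_mul' _ _ ENNReal.ofReal_ne_top,
              lintegral_const_mul' _ _ ENNReal.ofReal_ne_top]
            gcongr
            exact hR_le ω
    · refine ENNReal.ofReal_le_ofReal ?_
      calc _ ≤ ∑ i ∈ Finset.range V.n, ((σ (i + 1) : ℝ) - σ i) * c ^ (2 * (k + 1)) := by
            refine Finset.sum_le_sum fun i _ ↦ mul_le_mul_of_nonneg_left ?_ (hd0 i)
            rw [hp']
            exact pow_le_pow_left₀ (abs_nonneg _) (abs_clip_le hc.le _) _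
        _ = ((σ V.n : ℝ) - σ 0) * c ^ (2 * (k + 1)) := by
            rw [← Finset.sum_mul, Finset.sum_range_sub (fun i ↦ (σ i : ℝ))]
        _ ≤ _ := by gcongr
  have hmin : ∀ ω, ENNReal.ofReal
      (min (elementaryQuad σ (fun i ω ↦ ξ i ω - clip c (ξ i ω)) V.n ω) (4 * K)) ≤
      4 * min (L ω) (ENNReal.ofReal K) + min (2 * R ω) (4 * ENNReal.ofReal K) := by
    intro ω
    have e4 : ENNReal.ofReal (4 * K) = 4 * ENNReal.ofReal K := by
      rw [ENNReal.ofReal_mul (by norm_num), ENNReal.ofReal_ofNat]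
    rw [(ENNReal.ofReal_mono).map_min, e4]
    rcases le_total (L ω) (ENNReal.ofReal K) with h | h
    · rw [min_eq_left h, ← min_add_add_left]
      refine le_min ((min_le_left _ _).trans ((hA ω).trans ?_)) ((min_le_right _ _).trans
        le_add_self)
      gcongr
      norm_num
    · rw [min_eq_right h]
      exact (min_le_right _ _).trans le_self_add
  have hmain := measure_le_abs_elementarySum_clip hW (V.monotone_clampTime s t)
    (V.measurable_valueUpTo s t) k V.n hh hlen (show 0 < 4 * K by linarith) hε c
  refine (measure_mono ?_).trans (hmain.trans ?_)
  · rintro ω ⟨h1, h2, h3⟩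
    refine ⟨by rwa [← V.integral_sub_integral W hst.le], ?_⟩
    rw [← ENNReal.ofReal_le_ofReal_iff (by linarith)]
    refine (hA ω).trans ?_
    rw [show 4 * K = 2 * K + 2 * K by ring, ENNReal.ofReal_add (by linarith) (by linarith),
      ENNReal.ofReal_mul (by norm_num), ENNReal.ofReal_ofNat]
    gcongr
  · gcongr
    · refine (lintegral_mono hB).trans ?_
      rw [lintegral_add_left (hS_meas.const_mul _), lintegral_const_mul _ hS_meas]
    · refine (lintegral_mono hmin).trans ?_
      rw [lintegral_add_left ((hL_meas.min measurable_const).const_mul _),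
        lintegral_const_mul _ (hL_meas.min measurable_const)]

/-- The constant in `IsItoIntegral.measure_increment_le`. -/
noncomputable def tailConst (k : ℕ) : ℝ≥0∞ :=
  ENNReal.ofReal (Real.exp k) * momentConst k * ENNReal.ofReal (4 ^ (k + 1)) +
    ENNReal.ofReal (Real.exp 1) * 4

theorem tailConst_ne_top (k : ℕ) : tailConst k ≠ ∞ := by
  unfold tailConst
  have := (momentConst_lt_top k).ne
  finiteness

/-- The basic estimate for increments of the Itô integral, by passage to the limit in
`SimpleProcess.measure_increment_le`. -/
theorem IsItoIntegral.measure_increment_le [IsProbabilityMeasure P] (hW : IsWienerProcess ℱ W P)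
    {T : ℝ≥0} {ϑ Z : ℝ≥0 → Ω → ℝ} (hZ : IsItoIntegral ℱ W P T ϑ Z)
    {θ : ℝ → Ω → ℝ} (hθ : Measurable (Function.uncurry θ))
    (hϑ : ∀ u ∈ Set.Icc (0 : ℝ) T, ∀ ω, ϑ u.toNNReal ω = θ u ω) (k : ℕ)
    {s t : ℝ≥0} (hst : s < t) (htT : t ≤ T) {c ε K : ℝ} (hc : 0 < c) (hε : 0 < ε) (hK : 0 < K) :
    P {ω | 4 * ε ≤ |Z t ω - Z s ω| ∧
        (∫⁻ u in Set.Icc (s : ℝ) t, ENNReal.ofReal ((θ u ω - clip c (θ u ω)) ^ 2))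
          ≤ ENNReal.ofReal K} ≤
      tailConst k * (ENNReal.ofReal (((t : ℝ) - s) ^ k / ε ^ (2 * (k + 1))) *
        ∫⁻ ω, (∫⁻ u in Set.Icc (s : ℝ) t,
            ENNReal.ofReal (clip c (θ u ω) ^ (2 * (k + 1)))) ∂P +
        ENNReal.ofReal (1 / ε ^ 2) * ∫⁻ ω, min (∫⁻ u in Set.Icc (s : ℝ) t,
            ENNReal.ofReal ((θ u ω - clip c (θ u ω)) ^ 2)) (ENNReal.ofReal K) ∂P) := by
  obtain ⟨V, hV, hVZ⟩ := hZ.exists_approx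
  set R : ℕ → Ω → ℝ≥0∞ := fun j ω ↦
    ∫⁻ u in Set.Icc (0 : ℝ) T, ‖(V j).eval u.toNNReal ω - θ u ω‖ₑ ^ 2 with hR
  have hR0 : ∀ δ : ℝ≥0∞, 0 < δ → Tendsto (fun j ↦ P {ω | δ ≤ R j ω}) atTop (𝓝 0) := by
    intro δ hδ
    refine (hV δ hδ).congr fun j ↦ ?_
    congr 1
    ext ω
    simp only [Set.mem_ofPred_eq, hR]
    rw [setLIntegral_congr_fun measurableSet_Icc fun u hu ↦ by rw [hϑ u hu ω]]
  set S := ∫⁻ ω, (∫⁻ u in Set.Icc (s : ℝ) t,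
            ENNReal.ofReal (clip c (θ u ω) ^ (2 * (k + 1)))) ∂P
  set L := ∫⁻ ω, min (∫⁻ u in Set.Icc (s : ℝ) t,
            ENNReal.ofReal ((θ u ω - clip c (θ u ω)) ^ 2)) (ENNReal.ofReal K) ∂P
  set a := ENNReal.ofReal (Real.exp k) * momentConst k with ha
  set p := ENNReal.ofReal (((t : ℝ) - s) ^ k / ε ^ (2 * (k + 1)))
  set q := ENNReal.ofReal (1 / ε ^ 2)
  have ha' : a ≠ ∞ := ENNReal.mul_ne_top ENNReal.ofReal_ne_top (momentConst_lt_top k).ne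
  have hεt := hVZ t htT (ENNReal.ofReal ε) (ENNReal.ofReal_pos.2 hε)
  have hεs := hVZ s (hst.le.trans htT) (ENNReal.ofReal ε) (ENNReal.ofReal_pos.2 hε)
  have hKR := hR0 (ENNReal.ofReal K) (ENNReal.ofReal_pos.2 hK)
  have m1 := tendsto_lintegral_min_of_tendsto_measure hR0
    (a := ENNReal.ofReal (4 ^ (k + 1) * (2 * c) ^ (2 * k)))
    (b := ENNReal.ofReal (((t : ℝ) - s) * c ^ (2 * (k + 1))))
    ENNReal.ofReal_ne_top ENNReal.ofReal_ne_top
  have m2 := tendsto_lintegral_min_of_tendsto_measure hR0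
    (a := 2) (b := 4 * ENNReal.ofReal K) (by simp) (by finiteness)
  have hlim := (((ENNReal.Tendsto.const_mul (a := a * p) (tendsto_const_nhds
      (x := ENNReal.ofReal (4 ^ (k + 1)) * S) |>.add m1)
      (Or.inr (ENNReal.mul_ne_top ha' ENNReal.ofReal_ne_top))).add
    (ENNReal.Tendsto.const_mul (a := ENNReal.ofReal (Real.exp 1) * q) (tendsto_const_nhds
      (x := 4 * L) |>.add m2) (Or.inr (by finiteness)))).add
    hKR).add (hεt.add hεs)
  refine (ge_of_tendsto hlim (Eventually.of_forall fun j ↦ ?_)).trans ?_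
  · have hsub : {ω | 4 * ε ≤ |Z t ω - Z s ω| ∧
        (∫⁻ u in Set.Icc (s : ℝ) t, ENNReal.ofReal ((θ u ω - clip c (θ u ω)) ^ 2))
          ≤ ENNReal.ofReal K} ⊆
        ({ω | 2 * ε ≤ |(V j).integral W t ω - (V j).integral W s ω| ∧
          (∫⁻ u in Set.Icc (s : ℝ) t, ENNReal.ofReal ((θ u ω - clip c (θ u ω)) ^ 2))
            ≤ ENNReal.ofReal K ∧ R j ω ≤ ENNReal.ofReal K} ∪
          {ω | ENNReal.ofReal K ≤ R j ω}) ∪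
        ({ω | ENNReal.ofReal ε ≤ edist ((V j).integral W t ω) (Z t ω)} ∪
          {ω | ENNReal.ofReal ε ≤ edist ((V j).integral W s ω) (Z s ω)}) := by
      rintro ω ⟨h1, h2⟩
      by_contra hcon
      simp only [Set.mem_union, Set.mem_ofPred_eq, not_or, not_le, edist_dist, Real.dist_eq,
        ENNReal.ofReal_lt_ofReal_iff hε] at hcon
      obtain ⟨⟨c1, c2⟩, c3, c4⟩ := hcon
      refine c1 ⟨?_, h2, c2.le⟩
      have e : Z t ω - Z s ω = ((V j).integral W t ω - (V j).integral W s ω)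
          - ((V j).integral W t ω - Z t ω) + ((V j).integral W s ω - Z s ω) := by ring
      rw [e] at h1
      have i1 := abs_add_le (((V j).integral W t ω - (V j).integral W s ω)
          - ((V j).integral W t ω - Z t ω)) ((V j).integral W s ω - Z s ω)
      have i2 := abs_sub ((V j).integral W t ω - (V j).integral W s ω)
        ((V j).integral W t ω - Z t ω)
      linarith
    refine (measure_mono hsub).trans ((measure_union_le _ _).trans ?_)
    refine add_le_add ((measure_union_le _ _).trans ?_) (measure_union_le _ _)
    exact add_le_add ((V j).measure_increment_le hW hθ k hst htT hc hε hK) le_rfl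
  · rw [tailConst, ← ha]
    simp only [add_zero, add_mul, mul_add]
    calc a * p * (ENNReal.ofReal (4 ^ (k + 1)) * S) + ENNReal.ofReal (Real.exp 1) * q * (4 * L)
        = a * ENNReal.ofReal (4 ^ (k + 1)) * (p * S) +
          ENNReal.ofReal (Real.exp 1) * 4 * (q * L) := by
          ring
      _ ≤ _ := add_le_add le_self_add le_add_self

end Limit

/-! ### Dyadic chaining -/

section Dyadic

/-- The dyadic approximation of `x` from below at level `n`. -/
noncomputable def dyadicFloor (n : ℕ) (x : ℝ) : ℝ := ⌊x * 2 ^ n⌋₊ / 2 ^ n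

theorem dyadicFloor_mem {x : ℝ} (hx : x ∈ Set.Icc (0 : ℝ) 1) (n : ℕ) :
    dyadicFloor n x ∈ Set.Icc (0 : ℝ) 1 := by
  have h2 : (0 : ℝ) < 2 ^ n := by positivity
  refine ⟨by unfold dyadicFloor; positivity, ?_⟩
  rw [dyadicFloor, div_le_one h2]
  refine (Nat.floor_le (mul_nonneg hx.1 h2.le)).trans ?_
  nlinarith [hx.2]

theorem tendsto_dyadicFloor {x : ℝ} (hx : 0 ≤ x) :
    Tendsto (fun n ↦ dyadicFloor n x) atTop (𝓝 x) := by
  have h0 : Tendsto (fun n : ℕ ↦ x - (1 / 2 : ℝ) ^ n) atTop (𝓝 (x - 0)) :=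
    tendsto_const_nhds.sub (tendsto_pow_atTop_nhds_zero_of_lt_one (by norm_num) (by norm_num))
  rw [sub_zero] at h0
  refine tendsto_of_tendsto_of_tendsto_of_le_of_le h0 tendsto_const_nhds (fun n ↦ ?_) fun n ↦ ?_
  · have h2 : (0 : ℝ) < 2 ^ n := by positivity
    have := Nat.lt_floor_add_one (x * 2 ^ n)
    dsimp only
    rw [dyadicFloor, le_div_iff₀ h2, sub_mul, ← mul_pow]
    norm_num
    linarith
  · have h2 : (0 : ℝ) < 2 ^ n := by positivity
    dsimp only
    rw [dyadicFloor, div_le_iff₀ h2]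
    exact Nat.floor_le (by positivity)

theorem exists_abs_sub_le_of_dyadic {g : ℝ → ℝ} (hg : ContinuousOn g (Set.Icc 0 1)) {α : ℝ}
    (hα : 0 < α) {C : ℝ} (hC : 0 ≤ C) (hinc : ∀ n : ℕ, ∀ j < 2 ^ n,
      |g ((j + 1 : ℕ) / 2 ^ n) - g ((j : ℕ) / 2 ^ n)| ≤ C * ((2 : ℝ) ^ (-α)) ^ n) :
    ∃ D : ℝ, 0 ≤ D ∧ ∀ x ∈ Set.Icc (0 : ℝ) 1, ∀ y ∈ Set.Icc (0 : ℝ) 1, x < y →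
      |g y - g x| ≤ D * (y - x) ^ α := by
  set ρ : ℝ := (2 : ℝ) ^ (-α) with hρ
  have hρ0 : 0 < ρ := by positivity
  have hρ1 : ρ < 1 := Real.rpow_lt_one_of_one_lt_of_neg (by norm_num) (by linarith)
  have h1ρ : 0 < 1 - ρ := by linarith
  have hstep : ∀ x ∈ Set.Icc (0 : ℝ) 1, ∀ n,
      dist (g (dyadicFloor n x)) (g (dyadicFloor (n + 1) x)) ≤ C * ρ * ρ ^ n := by
    intro x hx n
    have h2 : (0 : ℝ) < 2 ^ n := by positivity
    have hy0 : 0 ≤ x * 2 ^ n := mul_nonneg hx.1 h2.le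
    have hle : ⌊x * 2 ^ (n + 1)⌋₊ ≤ 2 ^ (n + 1) := by
      refine Nat.floor_le_of_le ?_
      push_cast
      have : (0 : ℝ) < 2 ^ (n + 1) := by positivity
      nlinarith [hx.2]
    have e : dyadicFloor n x = (2 * ⌊x * 2 ^ n⌋₊ : ℕ) / 2 ^ (n + 1) := by
      rw [dyadicFloor, pow_succ]; push_cast; field_simp
    have hl : 2 * ⌊x * 2 ^ n⌋₊ ≤ ⌊x * 2 ^ (n + 1)⌋₊ := by
      refine Nat.le_floor ?_
      push_cast
      have := Nat.floor_le hy0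
      rw [pow_succ]; linarith
    have hu : ⌊x * 2 ^ (n + 1)⌋₊ < 2 * ⌊x * 2 ^ n⌋₊ + 2 := by
      rw [Nat.floor_lt (mul_nonneg hx.1 (by positivity))]
      push_cast
      have := Nat.lt_floor_add_one (x * 2 ^ n)
      rw [pow_succ]; linarith
    rw [e, dyadicFloor]
    rcases (by omega : ⌊x * 2 ^ (n + 1)⌋₊ = 2 * ⌊x * 2 ^ n⌋₊ ∨
      ⌊x * 2 ^ (n + 1)⌋₊ = 2 * ⌊x * 2 ^ n⌋₊ + 1) with h | h
    · rw [h, dist_self]; positivity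
    · rw [dist_comm, Real.dist_eq, h]
      refine (hinc (n + 1) _ (by omega)).trans (le_of_eq ?_)
      rw [pow_succ]; ring
  have hlim : ∀ x ∈ Set.Icc (0 : ℝ) 1, ∀ n,
      dist (g (dyadicFloor n x)) (g x) ≤ C * ρ * ρ ^ n / (1 - ρ) := by
    intro x hx n
    refine dist_le_of_le_geometric_of_tendsto ρ (C * ρ) hρ1 (hstep x hx) ?_ n
    have h := hg x hx
    exact h.tendsto.comp (tendsto_nhdsWithin_iff.2
      ⟨tendsto_dyadicFloor hx.1, Eventually.of_forall fun n ↦ dyadicFloor_mem hx n⟩)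
  refine ⟨(C + 2 * (C * ρ / (1 - ρ))) / ρ, by positivity, fun x hx y hy hxy ↦ ?_⟩
  obtain ⟨n, hn1, hn2⟩ := exists_nat_pow_near_of_lt_one (x := y - x) (y := (1 / 2 : ℝ))
    (by linarith) (by linarith [hx.1, hy.2]) (by norm_num) (by norm_num)
  have h2 : (0 : ℝ) < 2 ^ n := by positivity
  have hpow : ρ ^ n ≤ (y - x) ^ α / ρ := by
    rw [le_div_iff₀ hρ0, ← pow_succ, hρ, Real.rpow_neg (by norm_num),
      ← Real.inv_rpow (by norm_num), ← Real.rpow_natCast, ← Real.rpow_mul (by norm_num),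
      mul_comm α, Real.rpow_mul (by norm_num), Real.rpow_natCast]
    refine Real.rpow_le_rpow (by positivity) ?_ hα.le
    rw [← one_div]; exact hn1.le
  have hmid : |g (dyadicFloor n y) - g (dyadicFloor n x)| ≤ C * ρ ^ n := by
    have hyx : y * 2 ^ n ≤ x * 2 ^ n + 1 := by
      have := mul_le_mul_of_nonneg_right hn2 h2.le
      rw [← mul_pow] at this
      norm_num at this
      linarith
    have hl : ⌊x * 2 ^ n⌋₊ ≤ ⌊y * 2 ^ n⌋₊ := Nat.floor_le_floor (by gcongr)
    have hu : ⌊y * 2 ^ n⌋₊ ≤ ⌊x * 2 ^ n⌋₊ + 1 := by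
      rw [← Nat.floor_add_one (mul_nonneg hx.1 h2.le)]
      exact Nat.floor_le_floor hyx
    have hle : ⌊y * 2 ^ n⌋₊ ≤ 2 ^ n := by
      refine Nat.floor_le_of_le ?_
      push_cast
      nlinarith [hy.2]
    rw [dyadicFloor, dyadicFloor]
    rcases (by omega : ⌊y * 2 ^ n⌋₊ = ⌊x * 2 ^ n⌋₊ ∨ ⌊y * 2 ^ n⌋₊ = ⌊x * 2 ^ n⌋₊ + 1) with h | h
    · rw [h, sub_self, abs_zero]; positivity
    · rw [h]
      exact hinc n _ (by omega)
  have hx' := hlim x hx n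
  have hy' := hlim y hy n
  rw [Real.dist_eq] at hx' hy'
  rw [abs_sub_comm] at hy'
  have e : g y - g x = (g y - g (dyadicFloor n y)) + (g (dyadicFloor n y) - g (dyadicFloor n x))
      + (g (dyadicFloor n x) - g x) := by ring
  calc |g y - g x| ≤ |g y - g (dyadicFloor n y)| + |g (dyadicFloor n y) - g (dyadicFloor n x)|
      + |g (dyadicFloor n x) - g x| := by
        rw [e]
        exact abs_add_three _ _ _
    _ ≤ C * ρ * ρ ^ n / (1 - ρ) + C * ρ ^ n + C * ρ * ρ ^ n / (1 - ρ) := by gcongr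
    _ = (C + 2 * (C * ρ / (1 - ρ))) * ρ ^ n := by ring
    _ ≤ (C + 2 * (C * ρ / (1 - ρ))) * ((y - x) ^ α / ρ) := by gcongr
    _ = _ := by ring

theorem exists_holderOnWith_of_abs_sub_le {f : ℝ≥0 → ℝ} {T α : ℝ≥0} {D : ℝ}
    (h : ∀ s t : ℝ≥0, s < t → t ≤ T → |f t - f s| ≤ D * ((t : ℝ) - s) ^ (α : ℝ)) :
    ∃ C : ℝ≥0, HolderOnWith C α f (Set.Iic T) := by
  refine ⟨D.toNNReal, fun s hs t ht ↦ ?_⟩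
  wlog hst : s ≤ t generalizing s t
  · rw [edist_comm, edist_comm s]
    exact this t ht s hs (le_of_not_ge hst)
  rcases eq_or_lt_of_le hst with rfl | hst
  · simp
  rw [edist_dist, dist_comm, Real.dist_eq, edist_dist, dist_comm, NNReal.dist_eq,
    abs_of_nonneg (sub_nonneg.2 (NNReal.coe_le_coe.2 hst.le)),
    ENNReal.ofReal_rpow_of_nonneg (sub_nonneg.2 (NNReal.coe_le_coe.2 hst.le)) α.coe_nonneg,
    ← ENNReal.ofReal_coe_nnreal, ← ENNReal.ofReal_mul (NNReal.coe_nonneg _)]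
  refine ENNReal.ofReal_le_ofReal ((h s t hst ht).trans ?_)
  have : (0 : ℝ) ≤ (t : ℝ) - s := sub_nonneg.2 (NNReal.coe_le_coe.2 hst.le)
  gcongr
  exact Real.le_coe_toNNReal D

theorem exists_holderOnWith_of_dyadic {f : ℝ≥0 → ℝ} {T α : ℝ≥0} (hT : 0 < T) (hα : 0 < α)
    (hf : ContinuousOn f (Set.Iic T)) {C : ℝ} (hC : 0 ≤ C) (hinc : ∀ n : ℕ, ∀ j < 2 ^ n,
      |f (T * (j + 1 : ℕ) / 2 ^ n) - f (T * (j : ℕ) / 2 ^ n)| ≤ C * ((2 : ℝ) ^ (-α : ℝ)) ^ n) :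
    ∃ C : ℝ≥0, HolderOnWith C α f (Set.Iic T) := by
  have hT' : (0 : ℝ) < T := hT
  have hcont : ContinuousOn (fun x : ℝ ↦ f (T * x.toNNReal)) (Set.Icc 0 1) := by
    refine hf.comp (by fun_prop) fun x hx ↦ ?_
    simp only [Set.mem_Iic]
    exact mul_le_of_le_one_right zero_le (Real.toNNReal_le_one.2 hx.2)
  have hcast : ∀ n j : ℕ, T * ((j : ℝ) / 2 ^ n).toNNReal = T * (j : ℕ) / 2 ^ n := by
    intro n j
    rw [show ((j : ℝ) / 2 ^ n) = ((j / 2 ^ n : ℝ≥0) : ℝ) by push_cast; rfl, Real.toNNReal_coe,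
      mul_div_assoc]
  obtain ⟨D, _, hD⟩ := exists_abs_sub_le_of_dyadic hcont (α := α) hα hC fun n j hj ↦ by
    have := hinc n j hj
    rwa [hcast, hcast]
  refine exists_holderOnWith_of_abs_sub_le (D := D / (T : ℝ) ^ (α : ℝ)) fun s t hst ht ↦ ?_
  have hst' : (s : ℝ) < t := hst
  have ht' : (t : ℝ) ≤ T := ht
  have key : ∀ r : ℝ≥0, T * ((r : ℝ) / T).toNNReal = r := by
    intro r
    rw [← NNReal.coe_div, Real.toNNReal_coe]
    exact mul_div_cancel₀ r hT.ne'
  have h := hD (s / T) ⟨by positivity, by rw [div_le_one hT']; linarith⟩ (t / T)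
    ⟨by positivity, by rwa [div_le_one hT']⟩ (by gcongr)
  simp only [key] at h
  rw [← sub_div, Real.div_rpow (by linarith) hT'.le] at h
  refine h.trans (le_of_eq ?_)
  ring

end Dyadic

/-! ### Borel–Cantelli and interpolation sums -/

section BorelCantelli

variable {Ω : Type*} {mΩ : MeasurableSpace Ω} {P : Measure Ω}

/-- Borel–Cantelli: if the probabilities of the events that a dyadic increment is large and `good`
holds are summable, almost every path that is eventually in `good` is Hölder continuous. -/
theorem ae_holder_of_tsum_measure {Z : ℝ≥0 → Ω → ℝ} {T α : ℝ≥0} (hT : 0 < T) (hα : 0 < α)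
    (hcont : ∀ᵐ ω ∂P, ContinuousOn (fun t ↦ Z t ω) (Set.Iic T)) {C : ℝ} (hC : 0 ≤ C)
    (good : ℕ → ℕ → Set Ω)
    (hsum : ∑' n : ℕ, ∑ j ∈ Finset.range (2 ^ n), P {ω | C * ((2 : ℝ) ^ (-α : ℝ)) ^ n ≤
      |Z (T * (j + 1 : ℕ) / 2 ^ n) ω - Z (T * (j : ℕ) / 2 ^ n) ω| ∧ ω ∈ good n j} ≠ ∞) :
    ∀ᵐ ω ∂P, (∀ᶠ n in atTop, ∀ j < 2 ^ n, ω ∈ good n j) →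
      ∃ D : ℝ≥0, HolderOnWith D α (fun t ↦ Z t ω) (Set.Iic T) := by
  set ρ : ℝ := (2 : ℝ) ^ (-α : ℝ) with hρ
  have hρ0 : 0 < ρ := by positivity
  set bad : ℕ → Set Ω := fun n ↦ ⋃ j ∈ Finset.range (2 ^ n), {ω | C * ρ ^ n ≤
      |Z (T * (j + 1 : ℕ) / 2 ^ n) ω - Z (T * (j : ℕ) / 2 ^ n) ω| ∧ ω ∈ good n j} with hbad
  have hbadsum : ∑' n, P (bad n) ≠ ∞ :=
    ne_top_of_le_ne_top hsum (ENNReal.tsum_le_tsum fun n ↦ measure_biUnion_finset_le _ _)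
  filter_upwards [hcont, ae_eventually_notMem hbadsum] with ω hc hev hgood
  obtain ⟨N, hN⟩ := eventually_atTop.1 (hev.and hgood)
  set D : ℝ := ∑ n ∈ Finset.range N, ∑ j ∈ Finset.range (2 ^ n),
    |Z (T * (j + 1 : ℕ) / 2 ^ n) ω - Z (T * (j : ℕ) / 2 ^ n) ω| / ρ ^ n with hD
  have hD0 : 0 ≤ D := Finset.sum_nonneg fun n _ ↦ Finset.sum_nonneg fun j _ ↦ by positivity
  refine exists_holderOnWith_of_dyadic hT hα hc (C := C + D) (by positivity) fun n j hj ↦ ?_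
  rw [← hρ]
  rcases lt_or_ge n N with h | h
  · have h1 : |Z (T * (j + 1 : ℕ) / 2 ^ n) ω - Z (T * (j : ℕ) / 2 ^ n) ω| / ρ ^ n ≤ D :=
      (Finset.single_le_sum (f := fun j : ℕ ↦
        |Z (T * (j + 1 : ℕ) / 2 ^ n) ω - Z (T * (j : ℕ) / 2 ^ n) ω| / ρ ^ n)
        (fun j _ ↦ by positivity) (Finset.mem_range.2 hj)).trans
      (Finset.single_le_sum (f := fun n : ℕ ↦ ∑ j ∈ Finset.range (2 ^ n),
        |Z (T * (j + 1 : ℕ) / 2 ^ n) ω - Z (T * (j : ℕ) / 2 ^ n) ω| / ρ ^ n)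
        (fun n _ ↦ Finset.sum_nonneg fun j _ ↦ by positivity) (Finset.mem_range.2 h))
    rw [div_le_iff₀ (by positivity)] at h1
    refine h1.trans ?_
    gcongr
    linarith
  · obtain ⟨hn1, hn2⟩ := hN n h
    have h1 : |Z (T * (j + 1 : ℕ) / 2 ^ n) ω - Z (T * (j : ℕ) / 2 ^ n) ω| < C * ρ ^ n := by
      by_contra hcon
      exact hn1 (Set.mem_biUnion (Finset.mem_range.2 hj) ⟨not_lt.1 hcon, hn2 j hj⟩)
    refine h1.le.trans ?_
    gcongr
    linarith

theorem sum_setLIntegral_dyadic_le (T : ℝ≥0) (n : ℕ) (g : ℝ → ℝ≥0∞) :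
    ∑ j ∈ Finset.range (2 ^ n), ∫⁻ u in
        Set.Icc ((T * (j : ℕ) / 2 ^ n : ℝ≥0) : ℝ) ((T * (j + 1 : ℕ) / 2 ^ n : ℝ≥0) : ℝ), g u
      ≤ ∫⁻ u in Set.Icc (0 : ℝ) T, g u := by
  set f : ℕ → ℝ := fun j ↦ ((T * (j : ℕ) / 2 ^ n : ℝ≥0) : ℝ) with hf
  have hmono : Monotone f := fun a b h ↦ by
    simp only [hf]
    gcongr
  have hdisj : Set.PairwiseDisjoint (↑(Finset.range (2 ^ n)) : Set ℕ)
      fun j ↦ Set.Ioc (f j) (f (j + 1)) :=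
    fun i _ j _ hij ↦ (hmono.pairwise_disjoint_on_Ioc_succ) hij
  calc _ = ∑ j ∈ Finset.range (2 ^ n), ∫⁻ u in Set.Ioc (f j) (f (j + 1)), g u :=
        Finset.sum_congr rfl fun j _ ↦ setLIntegral_congr Ioc_ae_eq_Icc.symm
    _ = ∫⁻ u in ⋃ j ∈ Finset.range (2 ^ n), Set.Ioc (f j) (f (j + 1)), g u :=
        (lintegral_biUnion_finset hdisj (fun _ _ ↦ measurableSet_Ioc) _).symm
    _ ≤ _ := by
        refine lintegral_mono_set (Set.iUnion₂_subset fun j hj u hu ↦ ⟨?_, hu.2.trans ?_⟩)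
        · exact (NNReal.coe_nonneg _).trans hu.1.le
        · refine (hmono (Finset.mem_range.1 hj)).trans (le_of_eq ?_)
          simp [hf]

variable {ℱ : Filtration ℝ≥0 mΩ} {W : ℝ≥0 → Ω → ℝ}

/-- A criterion for Hölder paths of the Itô integral, with a truncation height `c n` and a bound
`K n` on the excess for each dyadic scale. The minimum in `hsum2` serves both uses: a small
`K n` when the excess vanishes, and `K n` tending to infinity when the excess is integrable. -/
theorem IsItoIntegral.ae_holder_of_tsum [IsProbabilityMeasure P] (hW : IsWienerProcess ℱ W P)
    {T α : ℝ≥0} (hT : 0 < T) (hα : 0 < α) {ϑ Z : ℝ≥0 → Ω → ℝ} (hZ : IsItoIntegral ℱ W P T ϑ Z)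
    {θ : ℝ → Ω → ℝ} (hθ : Measurable (Function.uncurry θ))
    (hϑ : ∀ u ∈ Set.Icc (0 : ℝ) T, ∀ ω, ϑ u.toNNReal ω = θ u ω) (k : ℕ)
    {c K : ℕ → ℝ} (hc : ∀ n, 0 < c n) (hK : ∀ n, 0 < K n)
    (hsum1 : ∑' n : ℕ, ENNReal.ofReal ((T / 2 ^ n) ^ k /
        (((2 : ℝ) ^ (-α : ℝ)) ^ n) ^ (2 * (k + 1))) * ∫⁻ ω, (∫⁻ u in Set.Icc (0 : ℝ) T,
            ENNReal.ofReal (clip (c n) (θ u ω) ^ (2 * (k + 1)))) ∂P ≠ ∞)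
    (hsum2 : ∑' n : ℕ, ENNReal.ofReal (1 / (((2 : ℝ) ^ (-α : ℝ)) ^ n) ^ 2) *
        min (∫⁻ ω, (∫⁻ u in Set.Icc (0 : ℝ) T,
            ENNReal.ofReal ((θ u ω - clip (c n) (θ u ω)) ^ 2)) ∂P)
          (2 ^ n * ENNReal.ofReal (K n)) ≠ ∞) :
    ∀ᵐ ω ∂P, (∀ᶠ n in atTop, (∫⁻ u in Set.Icc (0 : ℝ) T,
        ENNReal.ofReal ((θ u ω - clip (c n) (θ u ω)) ^ 2)) ≤ ENNReal.ofReal (K n)) →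
      ∃ D : ℝ≥0, HolderOnWith D α (fun t ↦ Z t ω) (Set.Iic T) := by
  set ρ : ℝ := (2 : ℝ) ^ (-α : ℝ) with hρ
  have hρ0 : 0 < ρ := by positivity
  set I : ℕ → ℕ → Set ℝ := fun n j ↦
    Set.Icc ((T * (j : ℕ) / 2 ^ n : ℝ≥0) : ℝ) ((T * (j + 1 : ℕ) / 2 ^ n : ℝ≥0) : ℝ) with hI
  have hle : ∀ n j : ℕ, j < 2 ^ n → T * (j + 1 : ℕ) / 2 ^ n ≤ T := by
    intro n j hj
    have : ((j + 1 : ℕ) : ℝ≥0) ≤ 2 ^ n := by exact_mod_cast hj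
    rw [mul_div_assoc]
    exact mul_le_of_le_one_right zero_le (div_le_one_of_le₀ this (by positivity))
  have hcl : ∀ c, Measurable (clip c) := measurable_clip
  have key := ae_holder_of_tsum_measure (P := P) hT hα hZ.continuous_paths (C := 4) (by norm_num)
    (fun n j ↦ {ω | ∫⁻ u in I n j, ENNReal.ofReal ((θ u ω - clip (c n) (θ u ω)) ^ 2)
      ≤ ENNReal.ofReal (K n)}) ?_
  · filter_upwards [key] with ω hω hev
    refine hω (hev.mono fun n hn j hj ↦ (lintegral_mono_set ?_).trans hn)
    exact Set.Icc_subset_Icc (NNReal.coe_nonneg _) (NNReal.coe_le_coe.2 (hle n j hj))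
  refine ne_top_of_le_ne_top (ENNReal.mul_ne_top (tailConst_ne_top k)
    (ENNReal.add_ne_top.2 ⟨hsum1, hsum2⟩)) ?_
  rw [← ENNReal.tsum_add, ← ENNReal.tsum_mul_left]
  refine ENNReal.tsum_le_tsum fun n ↦ ?_
  set p := ENNReal.ofReal ((T / 2 ^ n) ^ k / (ρ ^ n) ^ (2 * (k + 1)))
  set q := ENNReal.ofReal (1 / (ρ ^ n) ^ 2)
  set F : ℝ → Ω → ℝ≥0∞ := fun u ω ↦ ENNReal.ofReal (clip (c n) (θ u ω) ^ (2 * (k + 1)))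
  set G : ℝ → Ω → ℝ≥0∞ := fun u ω ↦ ENNReal.ofReal ((θ u ω - clip (c n) (θ u ω)) ^ 2)
  have hF : Measurable (Function.uncurry F) :=
    (((hcl _).comp hθ).pow_const _).ennreal_ofReal
  have hG : Measurable (Function.uncurry G) :=
    ((hθ.sub ((hcl _).comp hθ)).pow_const _).ennreal_ofReal
  have hFI : ∀ j, Measurable fun ω ↦ ∫⁻ u in I n j, F u ω := fun j ↦ hF.lintegral_prod_left'
  have hGI : ∀ j, Measurable fun ω ↦ ∫⁻ u in I n j, G u ω := fun j ↦ hG.lintegral_prod_left'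
  have hterm : ∀ j ∈ Finset.range (2 ^ n), P {ω | 4 * ρ ^ n ≤
      |Z (T * (j + 1 : ℕ) / 2 ^ n) ω - Z (T * (j : ℕ) / 2 ^ n) ω| ∧
        ω ∈ {ω | ∫⁻ u in I n j, G u ω ≤ ENNReal.ofReal (K n)}} ≤
      tailConst k * (p * ∫⁻ ω, (∫⁻ u in I n j, F u ω) ∂P +
        q * ∫⁻ ω, min (∫⁻ u in I n j, G u ω) (ENNReal.ofReal (K n)) ∂P) := by
    intro j hj
    have hlt : T * (j : ℕ) / 2 ^ n < T * (j + 1 : ℕ) / 2 ^ n := by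
      gcongr
      exact j.lt_succ_self
    have h := hZ.measure_increment_le hW hθ hϑ k hlt (hle n j (Finset.mem_range.1 hj)) (hc n)
      (pow_pos hρ0 n) (hK n)
    have e : ((T * (j + 1 : ℕ) / 2 ^ n : ℝ≥0) : ℝ) - ((T * (j : ℕ) / 2 ^ n : ℝ≥0) : ℝ)
        = T / 2 ^ n := by
      push_cast; ring
    rw [e] at h
    exact h
  refine (Finset.sum_le_sum hterm).trans ?_
  rw [← Finset.mul_sum, Finset.sum_add_distrib, ← Finset.mul_sum, ← Finset.mul_sum]
  gcongr
  · rw [← lintegral_finsetSum _ fun j _ ↦ hFI j]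
    exact lintegral_mono fun ω ↦ sum_setLIntegral_dyadic_le T n fun u ↦ F u ω
  · refine le_min ?_ ?_
    · calc _ ≤ ∑ j ∈ Finset.range (2 ^ n), ∫⁻ ω, (∫⁻ u in I n j, G u ω) ∂P :=
            Finset.sum_le_sum fun j _ ↦ lintegral_mono fun ω ↦ min_le_left _ _
        _ = ∫⁻ ω, ∑ j ∈ Finset.range (2 ^ n), (∫⁻ u in I n j, G u ω) ∂P :=
            (lintegral_finsetSum _ fun j _ ↦ hGI j).symm
        _ ≤ _ := lintegral_mono fun ω ↦ sum_setLIntegral_dyadic_le T n fun u ↦ G u ω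
    · calc _ ≤ ∑ j ∈ Finset.range (2 ^ n), ∫⁻ _ : Ω, ENNReal.ofReal (K n) ∂P :=
            Finset.sum_le_sum fun j _ ↦ lintegral_mono fun ω ↦ min_le_right _ _
        _ = _ := by simp

end BorelCantelli

section Interpolation

theorem tsum_le_of_two_sided_geometric {a : ℕ → ℝ≥0∞} {M r s : ℝ≥0∞} (N : ℕ)
    (h1 : ∀ n ≤ N, a n ≤ M * r ^ (N - n)) (h2 : ∀ n, a (n + (N + 1)) ≤ M * s ^ n) :
    ∑' n, a n ≤ M * ((1 - r)⁻¹ + (1 - s)⁻¹) := by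
  have hsplit : ∑ n ∈ Finset.range (N + 1), a n + ∑' n, a (n + (N + 1)) = ∑' n, a n :=
    Summable.sum_add_tsum_nat_add' ENNReal.summable
  rw [← hsplit, mul_add]
  gcongr
  · calc ∑ n ∈ Finset.range (N + 1), a n
        ≤ ∑ n ∈ Finset.range (N + 1), M * r ^ (N - n) :=
          Finset.sum_le_sum fun n hn ↦ h1 n (Nat.lt_succ_iff.1 (Finset.mem_range.1 hn))
      _ = M * ∑ n ∈ Finset.range (N + 1), r ^ n := by
          rw [← Finset.mul_sum, ← Finset.sum_range_reflect (fun n ↦ r ^ n)]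
          simp
      _ ≤ M * (1 - r)⁻¹ := by
          gcongr
          rw [← ENNReal.tsum_geometric]
          exact ENNReal.sum_le_tsum _
  · rw [← ENNReal.tsum_geometric, ← ENNReal.tsum_mul_left]
    exact ENNReal.tsum_le_tsum h2

theorem one_sub_ofReal_inv_ne_top {r : ℝ} (hr : r < 1) : (1 - ENNReal.ofReal r)⁻¹ ≠ ∞ := by
  rw [ENNReal.inv_ne_top]
  have : ENNReal.ofReal r < 1 := by simpa using hr
  exact (tsub_pos_of_lt this).ne'

/-- The interpolation sum for the truncated part, with heights `b ^ n` and `b ^ p = 2`: the terms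
decay geometrically on both sides of the level `N` at which `b ^ n` passes `|w|`. -/
theorem tsum_clip_le {b w : ℝ} (hb : 1 < b) (k N : ℕ) (hw : |w| < b ^ (N + 1)) :
    ∑' n : ℕ, ENNReal.ofReal ((2 / b ^ (2 * (k + 1))) ^ n * clip (b ^ n) w ^ (2 * (k + 1))) ≤
      ENNReal.ofReal (2 * 2 ^ N) * ((1 - ENNReal.ofReal (1 / 2))⁻¹ +
        (1 - ENNReal.ofReal (2 / b ^ (2 * (k + 1))))⁻¹) := by
  have hb0 : 0 < b := by linarith
  have hp' : ∀ x : ℝ, x ^ (2 * (k + 1)) = |x| ^ (2 * (k + 1)) := fun x ↦ by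
      rw [pow_mul, pow_mul, sq_abs]
  refine tsum_le_of_two_sided_geometric N (fun n hn ↦ ?_) fun n ↦ ?_
  · rw [← ENNReal.ofReal_pow (by norm_num), ← ENNReal.ofReal_mul (by positivity)]
    refine ENNReal.ofReal_le_ofReal ?_
    calc (2 / b ^ (2 * (k + 1))) ^ n * clip (b ^ n) w ^ (2 * (k + 1))
        ≤ (2 / b ^ (2 * (k + 1))) ^ n * (b ^ n) ^ (2 * (k + 1)) := by
          rw [hp' (clip _ _)]
          gcongr
          exact abs_clip_le (by positivity) w
      _ = 2 ^ n := by
          rw [div_pow, ← pow_mul, ← pow_mul, mul_comm n]; field_simp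
      _ ≤ 2 * 2 ^ n := by linarith [pow_pos (two_pos (α := ℝ)) n]
      _ = 2 * 2 ^ N * (1 / 2) ^ (N - n) := by
          obtain ⟨d, rfl⟩ := Nat.exists_eq_add_of_le hn
          rw [Nat.add_sub_cancel_left, pow_add, one_div, inv_pow]; field_simp
  · rw [← ENNReal.ofReal_pow (by positivity), ← ENNReal.ofReal_mul (by positivity)]
    refine ENNReal.ofReal_le_ofReal ?_
    calc (2 / b ^ (2 * (k + 1))) ^ (n + (N + 1)) * clip (b ^ (n + (N + 1))) w ^ (2 * (k + 1))
        ≤ (2 / b ^ (2 * (k + 1))) ^ (n + (N + 1)) * (b ^ (N + 1)) ^ (2 * (k + 1)) := by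
          rw [hp' (clip _ _)]
          gcongr
          exact (abs_clip_le_abs (by positivity) w).trans hw.le
      _ = _ := by
          rw [pow_add _ n, div_pow _ _ (N + 1), ← pow_mul, ← pow_mul, mul_comm (N + 1),
            pow_succ 2 N]
          field_simp

/-- The interpolation sum for the excess: the terms grow geometrically up to the level `N` at which
`b ^ n` passes `|w|`, and vanish beyond it. -/
theorem tsum_sub_clip_le {b w : ℝ} (hb : 1 < b) (N : ℕ) (hw : |w| < b ^ (N + 1)) :
    ∑' n : ℕ, ENNReal.ofReal ((2 / b ^ 2) ^ n * (w - clip (b ^ n) w) ^ 2) ≤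
      ENNReal.ofReal (b ^ 2 * 2 ^ N) * ((1 - ENNReal.ofReal (b ^ 2 / 2))⁻¹ + (1 - 0)⁻¹) := by
  have hb0 : 0 < b := by linarith
  refine tsum_le_of_two_sided_geometric N (fun n hn ↦ ?_) fun n ↦ ?_
  · rw [← ENNReal.ofReal_pow (by positivity), ← ENNReal.ofReal_mul (by positivity)]
    refine ENNReal.ofReal_le_ofReal ?_
    calc (2 / b ^ 2) ^ n * (w - clip (b ^ n) w) ^ 2
        ≤ (2 / b ^ 2) ^ n * (b ^ (N + 1)) ^ 2 := by
          rw [← sq_abs (w - _)]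
          gcongr
          exact (abs_sub_clip_le (by positivity) w).trans hw.le
      _ = _ := by
          obtain ⟨d, rfl⟩ := Nat.exists_eq_add_of_le hn
          rw [Nat.add_sub_cancel_left, div_pow, div_pow]; field_simp; ring
  · have hle : |w| ≤ b ^ (n + (N + 1)) :=
      hw.le.trans (pow_le_pow_right₀ hb.le (Nat.le_add_left _ _))
    rw [clip_of_abs_le hle]
    simp

end Interpolation

/-! ### Regularity of paths -/

section QuadraticCharacteristic

variable {Ω : Type*}

theorem ofReal_abs_quadChar_sub {ϑ : ℝ≥0 → Ω → ℝ} {θ : ℝ → Ω → ℝ} {T : ℝ≥0} {ω : Ω}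
    (hϑ : ∀ u ∈ Set.Icc (0 : ℝ) T, ϑ u.toNNReal ω = θ u ω) (hθ : Measurable fun u ↦ θ u ω)
    (hfin : ∫⁻ u in Set.Icc (0 : ℝ) T, ‖θ u ω‖ₑ ^ 2 < ∞) {s t : ℝ≥0} (hst : s ≤ t) (htT : t ≤ T) :
    ENNReal.ofReal |quadChar ϑ t ω - quadChar ϑ s ω|
      = ∫⁻ u in Set.Ioc (s : ℝ) t, ‖θ u ω‖ₑ ^ 2 := by
  have hen : ∀ x : ℝ, ‖x ^ 2‖ₑ = ‖x‖ₑ ^ 2 := fun x ↦ enorm_pow x 2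
  have hint : IntegrableOn (fun u ↦ θ u ω ^ 2) (Set.Icc 0 T) := by
    refine ⟨(hθ.pow_const 2).aestronglyMeasurable, ?_⟩
    simpa only [HasFiniteIntegral, hen] using hfin
  have hq : ∀ r : ℝ≥0, r ≤ T → quadChar ϑ r ω = ∫ u in (0 : ℝ)..r, θ u ω ^ 2 := by
    intro r hr
    refine intervalIntegral.integral_congr fun u hu ↦ ?_
    rw [Set.uIcc_of_le r.coe_nonneg] at hu
    rw [hϑ u ⟨hu.1, hu.2.trans (NNReal.coe_le_coe.2 hr)⟩]
  have hii : ∀ r : ℝ≥0, r ≤ T → IntervalIntegrable (fun u ↦ θ u ω ^ 2) volume 0 r := by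
    intro r hr
    rw [intervalIntegrable_iff_integrableOn_Icc_of_le r.coe_nonneg]
    exact hint.mono_set (Set.Icc_subset_Icc le_rfl (NNReal.coe_le_coe.2 hr))
  have hst' : (s : ℝ) ≤ t := NNReal.coe_le_coe.2 hst
  have hint' : IntegrableOn (fun u ↦ θ u ω ^ 2) (Set.Ioc (s : ℝ) t) :=
    hint.mono_set fun u hu ↦ ⟨s.coe_nonneg.trans hu.1.le, hu.2.trans (NNReal.coe_le_coe.2 htT)⟩
  rw [hq t htT, hq s (hst.trans htT),
    intervalIntegral.integral_interval_sub_left (hii t htT) (hii s (hst.trans htT)),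
    intervalIntegral.integral_of_le hst', abs_of_nonneg (integral_nonneg fun u ↦ sq_nonneg _),
    ofReal_integral_eq_lintegral_ofReal hint' (ae_of_all _ fun u ↦ sq_nonneg _)]
  refine lintegral_congr fun u ↦ ?_
  rw [← Real.enorm_of_nonneg (sq_nonneg _), hen]

theorem exists_lipschitzOnWith_quadChar {ϑ : ℝ≥0 → Ω → ℝ} {θ : ℝ → Ω → ℝ} {T : ℝ≥0} {ω : Ω}
    (hϑ : ∀ u ∈ Set.Icc (0 : ℝ) T, ϑ u.toNNReal ω = θ u ω) (hθ : Measurable fun u ↦ θ u ω)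
    (hfin : ∫⁻ u in Set.Icc (0 : ℝ) T, ‖θ u ω‖ₑ ^ 2 < ∞) {N : ℝ}
    (hN : ∀ u ∈ Set.Icc (0 : ℝ) T, |θ u ω| ≤ N) :
    ∃ C : ℝ≥0, LipschitzOnWith C (fun t ↦ quadChar ϑ t ω) (Set.Iic T) := by
  simp_rw [← holderOnWith_one]
  refine exists_holderOnWith_of_abs_sub_le (D := N ^ 2) fun s t hst htT ↦ ?_
  have hst' : (0 : ℝ) ≤ (t : ℝ) - s := sub_nonneg.2 (NNReal.coe_le_coe.2 hst.le)
  rw [NNReal.coe_one, Real.rpow_one, ← ENNReal.ofReal_le_ofReal_iff (by positivity),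
    ofReal_abs_quadChar_sub hϑ hθ hfin hst.le htT]
  calc _ ≤ ∫⁻ u in Set.Ioc (s : ℝ) t, ENNReal.ofReal (N ^ 2) := by
        refine setLIntegral_mono measurable_const fun u hu ↦ ?_
        have h := hN u ⟨s.coe_nonneg.trans hu.1.le, hu.2.trans (NNReal.coe_le_coe.2 htT)⟩
        rw [← enorm_pow, Real.enorm_of_nonneg (sq_nonneg _), ← sq_abs]
        exact ENNReal.ofReal_le_ofReal (by gcongr)
    _ = _ := by
        rw [setLIntegral_const, Real.volume_Ioc, ENNReal.ofReal_mul (sq_nonneg _)]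

theorem exists_holderOnWith_quadChar {ϑ : ℝ≥0 → Ω → ℝ} {θ : ℝ → Ω → ℝ} {T : ℝ≥0} {ω : Ω}
    (hϑ : ∀ u ∈ Set.Icc (0 : ℝ) T, ϑ u.toNNReal ω = θ u ω) (hθ : Measurable fun u ↦ θ u ω)
    (hfin : ∫⁻ u in Set.Icc (0 : ℝ) T, ‖θ u ω‖ₑ ^ 2 < ∞) {p : ℝ} (hp : 2 < p)
    (hpfin : ∫⁻ u in Set.Icc (0 : ℝ) T, ‖θ u ω‖ₑ ^ p < ∞) {α : ℝ≥0} (hα : (α : ℝ) = 1 - 2 / p) :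
    ∃ C : ℝ≥0, HolderOnWith C α (fun t ↦ quadChar ϑ t ω) (Set.Iic T) := by
  set B := ∫⁻ u in Set.Icc (0 : ℝ) T, ‖θ u ω‖ₑ ^ p with hB
  have hp0 : 0 < p := by linarith
  refine exists_holderOnWith_of_abs_sub_le (D := (B ^ (2 / p)).toReal) fun s t hst htT ↦ ?_
  have hst' : (0 : ℝ) ≤ (t : ℝ) - s := sub_nonneg.2 (NNReal.coe_le_coe.2 hst.le)
  have hBp : B ^ (2 / p) ≠ ∞ := ENNReal.rpow_ne_top_of_nonneg (by positivity) hpfin.ne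
  rw [← ENNReal.ofReal_le_ofReal_iff (by positivity),
    ofReal_abs_quadChar_sub hϑ hθ hfin hst.le htT, ENNReal.ofReal_mul ENNReal.toReal_nonneg,
    ENNReal.ofReal_toReal hBp, ← ENNReal.ofReal_rpow_of_nonneg hst' α.coe_nonneg]
  have hconj : (p / 2).HolderConjugate ((p / 2) / (p / 2 - 1)) :=
    Real.HolderConjugate.conjExponent (by linarith)
  have h := ENNReal.lintegral_mul_le_Lp_mul_Lq (volume.restrict (Set.Ioc (s : ℝ) t)) hconj
    (f := fun u ↦ ‖θ u ω‖ₑ ^ 2) (g := fun _ ↦ 1) (hθ.enorm.pow_const 2).aemeasurable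
    aemeasurable_const
  simp only [Pi.mul_apply, mul_one, ENNReal.one_rpow, lintegral_const, one_mul,
    Measure.restrict_apply_univ, Real.volume_Ioc] at h
  refine h.trans ?_
  have e1 : 1 / (p / 2) = 2 / p := one_div_div _ _
  have e2 : 1 / (p / 2 / (p / 2 - 1)) = α := by
    rw [hα]; field_simp
  rw [e1, e2]
  gcongr
  calc _ = ∫⁻ u in Set.Ioc (s : ℝ) t, ‖θ u ω‖ₑ ^ p := by
        refine lintegral_congr fun u ↦ ?_
        rw [← ENNReal.rpow_natCast, ← ENNReal.rpow_mul]
        congr 1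
        push_cast; ring
    _ ≤ B := lintegral_mono_set fun u hu ↦
        ⟨s.coe_nonneg.trans hu.1.le, hu.2.trans (NNReal.coe_le_coe.2 htT)⟩

end QuadraticCharacteristic

section HolderPaths

variable {Ω : Type*} {mΩ : MeasurableSpace Ω} {P : Measure Ω}
  {ℱ : Filtration ℝ≥0 mΩ} {W : ℝ≥0 → Ω → ℝ}

/-- Paths of `Z` are Hölder continuous of each order below `1 / 2` on the event that `|θ| ≤ N`. -/
theorem IsItoIntegral.ae_holder_of_bounded [IsProbabilityMeasure P] (hW : IsWienerProcess ℱ W P)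
    {T α : ℝ≥0} (hT : 0 < T) (hα : 0 < α) (hα2 : α < 1 / 2) {ϑ Z : ℝ≥0 → Ω → ℝ}
    (hZ : IsItoIntegral ℱ W P T ϑ Z)
    {θ : ℝ → Ω → ℝ} (hθ : Measurable (Function.uncurry θ))
    (hϑ : ∀ u ∈ Set.Icc (0 : ℝ) T, ∀ ω, ϑ u.toNNReal ω = θ u ω) {N : ℝ} (hN : 0 < N) :
    ∀ᵐ ω ∂P, (∀ u ∈ Set.Icc (0 : ℝ) T, |θ u ω| ≤ N) →
      ∃ D : ℝ≥0, HolderOnWith D α (fun t ↦ Z t ω) (Set.Iic T) := by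
  set ρ : ℝ := (2 : ℝ) ^ (-α : ℝ) with hρ
  have hρ0 : 0 < ρ := by positivity
  have hα2' : (α : ℝ) < 1 / 2 := by exact_mod_cast hα2
  have hρ2 : 1 < 2 * ρ ^ 2 := by
    have e : 2 * ρ ^ 2 = (2 : ℝ) ^ (1 - 2 * (α : ℝ)) := by
      rw [hρ, ← Real.rpow_natCast, ← Real.rpow_mul (by norm_num), sub_eq_add_neg,
        Real.rpow_add (by norm_num), Real.rpow_one]
      congr 2
      push_cast; ring
    rw [e]
    exact Real.one_lt_rpow (by norm_num) (by linarith)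
  -- the `n`-th term of the first sum is a multiple of the `n`-th power of this ratio
  obtain ⟨k, hk⟩ : ∃ k : ℕ, (1 / 2 : ℝ) ^ k / ρ ^ (2 * (k + 1)) < 1 := by
    obtain ⟨k, hk⟩ := exists_pow_lt_of_lt_one (show 0 < ρ ^ 2 by positivity)
      (show 1 / (2 * ρ ^ 2) < 1 from (div_lt_one (by linarith)).2 hρ2)
    refine ⟨k, ?_⟩
    rw [div_lt_one (by positivity), pow_mul, pow_succ (ρ ^ 2)]
    rw [div_pow, mul_pow, one_pow, div_lt_iff₀ (by positivity)] at hk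
    rw [div_pow, one_pow, div_lt_iff₀ (by positivity)]
    linarith
  have hcl := measurable_clip N
  -- `K n` only has to beat the factor `(2 / ρ ^ 2) ^ n ≤ 4 ^ n`
  have key := hZ.ae_holder_of_tsum hW hT hα hθ hϑ k (c := fun _ ↦ N) (K := fun n ↦ (1 / 8) ^ n)
    (fun _ ↦ hN) (fun n ↦ by positivity) ?_ ?_
  · filter_upwards [key] with ω hω hb
    refine hω (Eventually.of_forall fun n ↦ ?_)
    rw [setLIntegral_congr_fun (g := fun _ ↦ 0) measurableSet_Icc fun u hu ↦ by
      simp only [clip_of_abs_le (hb u hu), sub_self]; simp]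
    simp
  · set q : ℝ := (1 / 2 : ℝ) ^ k / ρ ^ (2 * (k + 1)) with hq
    set S : ℝ≥0∞ := ∫⁻ ω, (∫⁻ u in Set.Icc (0 : ℝ) T,
      ENNReal.ofReal (clip N (θ u ω) ^ (2 * (k + 1)))) ∂P with hS
    have hSfin : S ≠ ∞ := by
      have hle : S ≤
          ∫⁻ _ : Ω, (∫⁻ _ in Set.Icc (0 : ℝ) T, ENNReal.ofReal (N ^ (2 * (k + 1)))) ∂P := by
        refine lintegral_mono fun ω ↦ lintegral_mono fun u ↦ ENNReal.ofReal_le_ofReal ?_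
        calc clip N (θ u ω) ^ (2 * (k + 1)) = |clip N (θ u ω)| ^ (2 * (k + 1)) := by
              rw [pow_mul, pow_mul, sq_abs]
          _ ≤ _ := pow_le_pow_left₀ (abs_nonneg _) (abs_clip_le hN.le _) _
      refine ne_top_of_le_ne_top ?_ hle
      simp only [lintegral_const, Measure.restrict_apply_univ, Real.volume_Icc, measure_univ,
        mul_one]
      exact ENNReal.mul_ne_top ENNReal.ofReal_ne_top ENNReal.ofReal_ne_top
    have e : ∀ n : ℕ, ENNReal.ofReal ((T / 2 ^ n) ^ k / (ρ ^ n) ^ (2 * (k + 1))) * S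
        = ENNReal.ofReal (T ^ k) * S * ENNReal.ofReal q ^ n := by
      intro n
      have : ((T : ℝ) / 2 ^ n) ^ k / (ρ ^ n) ^ (2 * (k + 1)) = T ^ k * q ^ n := by
        rw [hq, div_pow, div_pow, ← pow_mul, ← pow_mul, ← pow_mul, ← pow_mul, one_div, inv_pow,
          mul_comm n k, mul_comm n (2 * (k + 1))]
        field_simp
      rw [this, ENNReal.ofReal_mul (by positivity), ENNReal.ofReal_pow (p := q) (by positivity)]
      ring
    refine (tsum_congr e).trans_ne ?_
    rw [ENNReal.tsum_mul_left, ENNReal.tsum_geometric]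
    exact ENNReal.mul_ne_top (ENNReal.mul_ne_top ENNReal.ofReal_ne_top hSfin)
      (one_sub_ofReal_inv_ne_top hk)
  · have hle : ∀ n : ℕ, ENNReal.ofReal (1 / (ρ ^ n) ^ 2) *
        min (∫⁻ ω, (∫⁻ u in Set.Icc (0 : ℝ) T,
            ENNReal.ofReal ((θ u ω - clip N (θ u ω)) ^ 2)) ∂P)
          (2 ^ n * ENNReal.ofReal ((1 / 8) ^ n)) ≤ ENNReal.ofReal (1 / 2) ^ n := by
      intro n
      refine (mul_le_mul_right (min_le_right _ _) _).trans ?_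
      rw [← ENNReal.ofReal_ofNat 2, ← ENNReal.ofReal_pow (by norm_num),
        ← ENNReal.ofReal_mul (by positivity), ← ENNReal.ofReal_mul (by positivity),
        ← ENNReal.ofReal_pow (by norm_num)]
      refine ENNReal.ofReal_le_ofReal ?_
      rw [← pow_mul, mul_comm n 2, pow_mul, ← one_div_pow, ← mul_pow, ← mul_pow]
      refine pow_le_pow_left₀ (by positivity) ?_ n
      rw [one_div_mul_eq_div, div_le_iff₀ (by positivity)]
      linarith
    refine ne_top_of_le_ne_top ?_ (ENNReal.tsum_le_tsum hle)
    rw [ENNReal.tsum_geometric]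
    exact one_sub_ofReal_inv_ne_top (by norm_num)

/-- Paths of `Z` are Hölder continuous of the endpoint order `1 / 2 - 1 / p` if `θ` is in `L ^ p`,
`p > 2`. -/
theorem IsItoIntegral.ae_holder_of_lintegral_rpow [IsProbabilityMeasure P]
    (hW : IsWienerProcess ℱ W P) {T α : ℝ≥0} (hT : 0 < T) {ϑ Z : ℝ≥0 → Ω → ℝ}
    (hZ : IsItoIntegral ℱ W P T ϑ Z)
    {θ : ℝ → Ω → ℝ} (hθ : Measurable (Function.uncurry θ))
    (hϑ : ∀ u ∈ Set.Icc (0 : ℝ) T, ∀ ω, ϑ u.toNNReal ω = θ u ω)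
    (hfin : ∀ᵐ ω ∂P, ∫⁻ u in Set.Icc (0 : ℝ) T, ‖θ u ω‖ₑ ^ 2 < ∞) {p : ℝ} (hp : 2 < p)
    (hpfin : ∫⁻ ω, (∫⁻ u in Set.Icc (0 : ℝ) T, ‖θ u ω‖ₑ ^ p) ∂P < ∞)
    (hα : (α : ℝ) = 1 / 2 - 1 / p) :
    ∀ᵐ ω ∂P, ∃ D : ℝ≥0, HolderOnWith D α (fun t ↦ Z t ω) (Set.Iic T) := by
  have hp0 : 0 < p := by linarith
  set ρ : ℝ := (2 : ℝ) ^ (-α : ℝ) with hρ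
  have hρ0 : 0 < ρ := by positivity
  set b : ℝ := (2 : ℝ) ^ (1 / p) with hb
  have hb1 : 1 < b := Real.one_lt_rpow (by norm_num) (by positivity)
  have hb0 : 0 < b := by linarith
  have hα0 : 0 < α := by
    rw [← NNReal.coe_pos, hα, sub_pos]
    exact one_div_lt_one_div_of_lt (by norm_num) hp
  have hpow : ∀ m : ℕ, b ^ m = (2 : ℝ) ^ ((m : ℝ) / p) := fun m ↦ by
    rw [hb, ← Real.rpow_natCast, ← Real.rpow_mul (by norm_num)]
    congr 1; ring
  have hb2 : b ^ 2 < 2 := by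
    rw [hpow]
    calc (2 : ℝ) ^ (((2 : ℕ) : ℝ) / p) < 2 ^ (1 : ℝ) := by
          refine Real.rpow_lt_rpow_of_exponent_lt (by norm_num) ?_
          rw [div_lt_one hp0]; exact_mod_cast hp
      _ = 2 := Real.rpow_one 2
  have hbp : ∀ m : ℕ, (b ^ m) ^ p = 2 ^ m := fun m ↦ by
    rw [hpow, ← Real.rpow_mul (by norm_num), div_mul_cancel₀ _ hp0.ne', Real.rpow_natCast]
  have hρb : 1 / ρ ^ 2 = 2 / b ^ 2 := by
    rw [hpow, hρ, ← Real.rpow_natCast, ← Real.rpow_mul (by norm_num), one_div,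
      ← Real.rpow_neg (by norm_num), hα]
    calc (2 : ℝ) ^ (-(-(1 / 2 - 1 / p) * ((2 : ℕ) : ℝ))) = 2 ^ (1 - ((2 : ℕ) : ℝ) / p) := by
          congr 1; push_cast; ring
      _ = _ := by rw [Real.rpow_sub (by norm_num), Real.rpow_one]
  obtain ⟨k, hk⟩ := exists_nat_gt p
  have hkb : 2 < b ^ (2 * (k + 1)) := by
    rw [hpow]
    calc (2 : ℝ) = 2 ^ (1 : ℝ) := (Real.rpow_one 2).symm
      _ < _ := by
        refine Real.rpow_lt_rpow_of_exponent_lt (by norm_num) ?_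
        rw [lt_div_iff₀ hp0]
        push_cast
        have : (0 : ℝ) ≤ k := Nat.cast_nonneg k
        linarith
  -- the level `N` at which the dyadic threshold `b ^ n` exceeds `|w|`
  have hlevel : ∀ w : ℝ, ∃ N : ℕ, |w| < b ^ (N + 1) ∧ (2 : ℝ) ^ N ≤ 1 + |w| ^ p := by
    intro w
    have hw : 0 ≤ |w| ^ p := by positivity
    obtain ⟨N, h1, h2⟩ := exists_nat_pow_near (x := 1 + |w| ^ p) (y := (2 : ℝ)) (by linarith)
      (by norm_num)
    refine ⟨N, ?_, h1⟩
    rw [← Real.rpow_lt_rpow_iff (abs_nonneg w) (by positivity) hp0, hbp]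
    linarith
  have hofReal : ∀ w : ℝ, ENNReal.ofReal (1 + |w| ^ p) = 1 + ‖w‖ₑ ^ p := fun w ↦ by
    rw [ENNReal.ofReal_add (by norm_num) (by positivity), ENNReal.ofReal_one,
      ← ENNReal.ofReal_rpow_of_nonneg (abs_nonneg w) hp0.le, ← Real.norm_eq_abs, ofReal_norm]
  have hE : ∫⁻ ω, (∫⁻ u in Set.Icc (0 : ℝ) T, (1 + ‖θ u ω‖ₑ ^ p)) ∂P ≠ ∞ := by
    simp_rw [lintegral_add_left (f := fun _ : ℝ ↦ (1 : ℝ≥0∞)) measurable_const]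
    rw [lintegral_add_left measurable_const]
    refine ENNReal.add_ne_top.2 ⟨?_, hpfin.ne⟩
    simp
  have hcl := measurable_clip
  have hsumint : ∀ (g : ℕ → ℝ → ℝ≥0∞) (C : ℝ≥0∞), (∀ n, Measurable (g n)) → C ≠ ∞ →
      (∀ w, ∑' n, g n w ≤ C * (1 + ‖w‖ₑ ^ p)) →
      ∑' n, ∫⁻ ω, (∫⁻ u in Set.Icc (0 : ℝ) T, g n (θ u ω)) ∂P ≠ ∞ := by
    intro g C hg hC hle
    have hm : ∀ n, Measurable (Function.uncurry fun (u : ℝ) ω ↦ g n (θ u ω)) := fun n ↦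
      (hg n).comp hθ
    rw [← lintegral_tsum (f := fun n ω ↦ ∫⁻ u in Set.Icc (0 : ℝ) T, g n (θ u ω))
      fun n ↦ (hm n).lintegral_prod_left'.aemeasurable]
    refine ne_top_of_le_ne_top (ENNReal.mul_ne_top hC hE) ?_
    rw [← lintegral_const_mul' _ _ hC]
    refine lintegral_mono fun ω ↦ ?_
    dsimp only
    rw [← lintegral_tsum (f := fun n u ↦ g n (θ u ω)) fun n ↦
      ((hg n).comp (hθ.comp (measurable_id.prodMk measurable_const))).aemeasurable,
      ← lintegral_const_mul' _ _ hC]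
    exact lintegral_mono fun u ↦ hle _
  have key := hZ.ae_holder_of_tsum hW hT hα0 hθ hϑ k (c := fun n ↦ b ^ n)
    (K := fun n ↦ n + 1) (fun n ↦ by positivity) (fun n ↦ by positivity) ?_ ?_
  · filter_upwards [key, hfin] with ω hω hf
    refine hω ?_
    set A := ∫⁻ u in Set.Icc (0 : ℝ) T, ‖θ u ω‖ₑ ^ 2 with hA
    obtain ⟨n₀, hn₀⟩ := exists_nat_gt A.toReal
    refine eventually_atTop.2 ⟨n₀, fun n hn ↦ ?_⟩
    calc _ ≤ A := by
          refine lintegral_mono fun u ↦ ?_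
          rw [← enorm_pow, Real.enorm_of_nonneg (sq_nonneg _)]
          refine ENNReal.ofReal_le_ofReal (sq_le_sq.2 (abs_sub_clip_le (by positivity) _))
      _ = ENNReal.ofReal A.toReal := (ENNReal.ofReal_toReal hf.ne).symm
      _ ≤ _ := by
          refine ENNReal.ofReal_le_ofReal ?_
          have : (n₀ : ℝ) ≤ n := by exact_mod_cast hn
          linarith
  · have e : ∀ n : ℕ, ENNReal.ofReal ((T / 2 ^ n) ^ k / (ρ ^ n) ^ (2 * (k + 1))) *
        ∫⁻ ω, (∫⁻ u in Set.Icc (0 : ℝ) T,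
            ENNReal.ofReal (clip (b ^ n) (θ u ω) ^ (2 * (k + 1)))) ∂P
        = ENNReal.ofReal (T ^ k) * ∫⁻ ω, (∫⁻ u in Set.Icc (0 : ℝ) T,
            ENNReal.ofReal ((2 / b ^ (2 * (k + 1))) ^ n *
              clip (b ^ n) (θ u ω) ^ (2 * (k + 1)))) ∂P := by
      intro n
      have h1 : ((T : ℝ) / 2 ^ n) ^ k / (ρ ^ n) ^ (2 * (k + 1))
          = T ^ k * (2 / b ^ (2 * (k + 1))) ^ n := by
        have h2 : 1 / (ρ ^ n) ^ (2 * (k + 1)) = ((2 / b ^ 2) ^ (k + 1)) ^ n := by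
          rw [← hρb, ← pow_mul, ← pow_mul, one_div_pow, ← pow_mul]
          congr 2; ring
        rw [div_eq_mul_one_div, h2, div_pow, div_pow, ← pow_mul b, ← pow_mul, mul_comm n k,
          pow_mul, pow_succ (2 : ℝ)]
        rw [div_pow, mul_pow, div_pow]
        field_simp
      rw [h1, ENNReal.ofReal_mul (by positivity), mul_assoc]
      congr 1
      rw [← lintegral_const_mul' _ _ ENNReal.ofReal_ne_top]
      refine lintegral_congr fun ω ↦ ?_
      rw [← lintegral_const_mul' _ _ ENNReal.ofReal_ne_top]
      refine lintegral_congr fun u ↦ ?_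
      rw [ENNReal.ofReal_mul (by positivity)]
    refine (tsum_congr e).trans_ne ?_
    rw [ENNReal.tsum_mul_left]
    refine ENNReal.mul_ne_top ENNReal.ofReal_ne_top (hsumint (fun n w ↦
      ENNReal.ofReal ((2 / b ^ (2 * (k + 1))) ^ n * clip (b ^ n) w ^ (2 * (k + 1))))
      (2 * ((1 - ENNReal.ofReal (1 / 2))⁻¹ +
        (1 - ENNReal.ofReal (2 / b ^ (2 * (k + 1))))⁻¹)) (fun n ↦ ?_) ?_ fun w ↦ ?_)
    · exact (((hcl _).pow_const _).const_mul _).ennreal_ofReal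
    · exact ENNReal.mul_ne_top (by simp) (ENNReal.add_ne_top.2
        ⟨one_sub_ofReal_inv_ne_top (by norm_num),
          one_sub_ofReal_inv_ne_top ((div_lt_one (by positivity)).2 hkb)⟩)
    · obtain ⟨N, h1, h2⟩ := hlevel w
      refine (tsum_clip_le hb1 k N h1).trans ?_
      rw [← hofReal, ENNReal.ofReal_mul (by norm_num), ENNReal.ofReal_ofNat, mul_right_comm]
      gcongr
  · have e : ∀ n : ℕ, ENNReal.ofReal (1 / (ρ ^ n) ^ 2) *
        min (∫⁻ ω, (∫⁻ u in Set.Icc (0 : ℝ) T,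
            ENNReal.ofReal ((θ u ω - clip (b ^ n) (θ u ω)) ^ 2)) ∂P)
          (2 ^ n * ENNReal.ofReal (n + 1))
        ≤ ∫⁻ ω, (∫⁻ u in Set.Icc (0 : ℝ) T,
            ENNReal.ofReal ((2 / b ^ 2) ^ n * (θ u ω - clip (b ^ n) (θ u ω)) ^ 2)) ∂P := by
      intro n
      refine (mul_le_mul_right (min_le_left _ _) _).trans (le_of_eq ?_)
      have h1 : 1 / (ρ ^ n) ^ 2 = (2 / b ^ 2) ^ n := by
        rw [← hρb, one_div_pow, ← pow_mul, ← pow_mul, mul_comm]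
      rw [h1, ← lintegral_const_mul' _ _ ENNReal.ofReal_ne_top]
      refine lintegral_congr fun ω ↦ ?_
      rw [← lintegral_const_mul' _ _ ENNReal.ofReal_ne_top]
      refine lintegral_congr fun u ↦ ?_
      rw [ENNReal.ofReal_mul (by positivity)]
    refine ne_top_of_le_ne_top (hsumint (fun n w ↦
      ENNReal.ofReal ((2 / b ^ 2) ^ n * (w - clip (b ^ n) w) ^ 2))
      (ENNReal.ofReal (b ^ 2) * ((1 - ENNReal.ofReal (b ^ 2 / 2))⁻¹ + (1 - 0)⁻¹))
      (fun n ↦ ?_) ?_ fun w ↦ ?_) (ENNReal.tsum_le_tsum e)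
    · exact (((measurable_id.sub (hcl _)).pow_const _).const_mul _).ennreal_ofReal
    · exact ENNReal.mul_ne_top ENNReal.ofReal_ne_top (ENNReal.add_ne_top.2
        ⟨one_sub_ofReal_inv_ne_top (by linarith), by simp⟩)
    · obtain ⟨N, h1, h2⟩ := hlevel w
      refine (tsum_sub_clip_le hb1 N h1).trans ?_
      rw [← hofReal, ENNReal.ofReal_mul (by positivity), mul_right_comm]
      gcongr

end HolderPaths

/-! ### The three cases -/

theorem lemma3p1 {Ω : Type*} {mΩ : MeasurableSpace Ω} (P : Measure Ω) [IsProbabilityMeasure P]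
    (ℱ : Filtration ℝ≥0 mΩ) (W : ℝ≥0 → Ω → ℝ) (hW : IsWienerProcess ℱ W P)
    (T : ℝ≥0) (hT : 0 < T)
    (ϑ : ℝ≥0 → Ω → ℝ)
    (hprog : ∀ t ≤ T, Measurable[Subtype.instMeasurableSpace.prod (ℱ t)]
      fun p : Set.Iic t × Ω ↦ ϑ p.1 p.2)
    (hfin : ∀ᵐ ω ∂P, (∫⁻ s in Set.Icc (0 : ℝ) T, ‖ϑ s.toNNReal ω‖ₑ ^ 2) < ∞)
    (Z : ℝ≥0 → Ω → ℝ) (hZ : IsItoIntegral ℱ W P T ϑ Z) :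
    (Tendsto (fun C : ℝ≥0 ↦ P {ω | (C : ℝ≥0∞) ≤ ⨆ t ∈ Set.Iic T, ‖ϑ t ω‖ₑ}) atTop (𝓝 0) →
      (∀ α : ℝ≥0, 0 < α → α < 1 / 2 → HasHolderPaths P T Z α) ∧
        HasLipschitzPaths P T (quadChar ϑ)) ∧
    (∀ δ : ℝ≥0, 0 < δ →
      (⨆ t ∈ Set.Iic T, ∫⁻ ω, ‖ϑ t ω‖ₑ ^ (2 + δ : ℝ) ∂P) < ∞ →
      HasHolderPaths P T Z (δ / (4 + 2 * δ)) ∧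
        HasHolderPaths P T (quadChar ϑ) (δ / (2 + δ))) ∧
    (∀ δ : ℝ≥0, 0 < δ →
      (∫⁻ ω, (∫⁻ t in Set.Icc (0 : ℝ) T, ‖ϑ t.toNNReal ω‖ₑ ^ (4 + δ : ℝ)) ∂P) < ∞ →
      HasHolderPaths P T Z (δ / (8 + 2 * δ)) ∧
        HasHolderPaths P T (quadChar ϑ) (δ / (4 + δ))) := by
  -- a jointly measurable process on all of `ℝ` that agrees with `ϑ` on `[0, T]`
  set θ : ℝ → Ω → ℝ := fun u ω ↦ ϑ (min u.toNNReal T) ω with hθdef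
  have hϑ : ∀ u ∈ Set.Icc (0 : ℝ) T, ∀ ω, ϑ u.toNNReal ω = θ u ω := by
    intro u hu ω
    rw [hθdef]
    dsimp only
    rw [min_eq_left (Real.toNNReal_le_iff_le_coe.2 hu.2)]
  have hθ : Measurable (Function.uncurry θ) := by
    have h1 : Measurable fun p : Set.Iic T × Ω ↦ ϑ p.1 p.2 :=
      (hprog T le_rfl).mono (sup_le_sup le_rfl (MeasurableSpace.comap_mono (ℱ.le T))) le_rfl
    have h2 : Measurable fun p : ℝ × Ω ↦
        ((⟨min p.1.toNNReal T, Set.mem_Iic.2 (min_le_right _ _)⟩, p.2) : Set.Iic T × Ω) :=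
      ((measurable_fst.real_toNNReal.min measurable_const).subtype_mk).prodMk measurable_snd
    exact h1.comp h2
  have hθω : ∀ ω, Measurable fun u ↦ θ u ω := fun ω ↦
    hθ.comp (measurable_id.prodMk measurable_const)
  have hfin' : ∀ᵐ ω ∂P, ∫⁻ u in Set.Icc (0 : ℝ) T, ‖θ u ω‖ₑ ^ 2 < ∞ := by
    filter_upwards [hfin] with ω hω
    rwa [setLIntegral_congr_fun measurableSet_Icc fun u hu ↦ by rw [hϑ u hu ω]] at hω
  have moment : ∀ p : ℝ, 2 < p → (∫⁻ ω, (∫⁻ u in Set.Icc (0 : ℝ) T, ‖θ u ω‖ₑ ^ p) ∂P) < ∞ →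
      (∀ α : ℝ≥0, (α : ℝ) ≤ 1 / 2 - 1 / p → HasHolderPaths P T Z α) ∧
      (∀ α : ℝ≥0, (α : ℝ) ≤ 1 - 2 / p → HasHolderPaths P T (quadChar ϑ) α) := by
    intro p hp hpfin
    have hp0 : 0 < p := by linarith
    have hdiam : ∀ x ∈ Set.Iic T, ∀ y ∈ Set.Iic T, edist x y ≤ T := by
      intro x hx y hy
      rw [edist_nndist, ENNReal.coe_le_coe, ← NNReal.coe_le_coe, coe_nndist, NNReal.dist_eq,
        abs_le]
      have hx' : (x : ℝ) ≤ T := hx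
      have hy' : (y : ℝ) ≤ T := hy
      constructor <;> linarith [x.coe_nonneg, y.coe_nonneg]
    constructor
    · intro α hα
      have hβ : (0 : ℝ) ≤ 1 / 2 - 1 / p := α.coe_nonneg.trans hα
      have h := hZ.ae_holder_of_lintegral_rpow hW hT hθ hϑ hfin' hp hpfin
        (α := ⟨1 / 2 - 1 / p, hβ⟩) rfl
      filter_upwards [h] with ω ⟨D, hD⟩
      exact ⟨_, hD.of_le hdiam hα⟩
    · intro α hα
      have hβ : (0 : ℝ) ≤ 1 - 2 / p := α.coe_nonneg.trans hα
      have hae : ∀ᵐ ω ∂P, ∫⁻ u in Set.Icc (0 : ℝ) T, ‖θ u ω‖ₑ ^ p < ∞ := by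
        refine ae_lt_top ?_ hpfin.ne
        exact Measurable.lintegral_prod_left' (f := fun q : ℝ × Ω ↦ ‖θ q.1 q.2‖ₑ ^ p)
          (hθ.enorm.pow_const p)
      filter_upwards [hfin', hae] with ω h1 h2
      obtain ⟨D, hD⟩ := exists_holderOnWith_quadChar (fun u hu ↦ hϑ u hu ω) (hθω ω) h1 hp h2
        (α := ⟨1 - 2 / p, hβ⟩) rfl
      exact ⟨_, hD.of_le hdiam hα⟩
  refine ⟨fun hsup ↦ ?_, fun δ hδ hmom ↦ ?_, fun δ hδ hmom ↦ ?_⟩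
  · have htop : P {ω | (⨆ t ∈ Set.Iic T, ‖ϑ t ω‖ₑ) = ∞} = 0 := by
      refine le_antisymm (ge_of_tendsto hsup (Eventually.of_forall fun C ↦ measure_mono ?_)) zero_le
      intro ω hω
      simp only [Set.mem_ofPred_eq] at hω ⊢
      rw [hω]
      exact le_top
    have hbdd : ∀ᵐ ω ∂P, ∃ N : ℕ, ∀ u ∈ Set.Icc (0 : ℝ) T, |θ u ω| ≤ N + 1 := by
      have : ∀ᵐ ω ∂P, (⨆ t ∈ Set.Iic T, ‖ϑ t ω‖ₑ) ≠ ∞ := by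
        rw [ae_iff]
        simpa using htop
      filter_upwards [this] with ω hω
      obtain ⟨N, hN⟩ := ENNReal.exists_nat_gt hω
      refine ⟨N, fun u hu ↦ ?_⟩
      have h1 : ‖θ u ω‖ₑ ≤ ⨆ t ∈ Set.Iic T, ‖ϑ t ω‖ₑ :=
        le_iSup₂ (f := fun t (_ : t ∈ Set.Iic T) ↦ ‖ϑ t ω‖ₑ) (min u.toNNReal T)
          (Set.mem_Iic.2 (min_le_right _ _))
      have h2 := h1.trans hN.le
      rw [← ofReal_norm, ← ENNReal.ofReal_natCast,
        ENNReal.ofReal_le_ofReal_iff (Nat.cast_nonneg N), Real.norm_eq_abs] at h2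
      linarith
    refine ⟨fun α hα hα2 ↦ ?_, ?_⟩
    · have h := ae_all_iff.2 fun N : ℕ ↦ hZ.ae_holder_of_bounded hW hT hα hα2 hθ hϑ
        (N := N + 1) (by positivity)
      filter_upwards [h, hbdd] with ω hω ⟨N, hN⟩
      exact hω N hN
    · filter_upwards [hbdd, hfin'] with ω ⟨N, hN⟩ hf
      exact exists_lipschitzOnWith_quadChar (fun u hu ↦ hϑ u hu ω) (hθω ω) hf hN
  · have hδ' : (0 : ℝ) < δ := hδ
    have hp : (∫⁻ ω, (∫⁻ u in Set.Icc (0 : ℝ) T, ‖θ u ω‖ₑ ^ (2 + δ : ℝ)) ∂P) < ∞ := by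
      set B := ⨆ t ∈ Set.Iic T, ∫⁻ ω, ‖ϑ t ω‖ₑ ^ (2 + δ : ℝ) ∂P with hB
      have hm : Measurable (Function.uncurry fun ω u ↦ ‖θ u ω‖ₑ ^ (2 + δ : ℝ)) :=
        (hθ.enorm.pow_const (2 + δ : ℝ)).comp measurable_swap
      rw [lintegral_lintegral_swap hm.aemeasurable]
      calc _ ≤ ∫⁻ _ in Set.Icc (0 : ℝ) T, B := by
            refine lintegral_mono fun u ↦ ?_
            exact le_iSup₂ (f := fun t (_ : t ∈ Set.Iic T) ↦ ∫⁻ ω, ‖ϑ t ω‖ₑ ^ (2 + δ : ℝ) ∂P)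
              (min u.toNNReal T) (Set.mem_Iic.2 (min_le_right _ _))
        _ < ∞ := by
            rw [setLIntegral_const, Real.volume_Icc]
            exact ENNReal.mul_lt_top hmom ENNReal.ofReal_lt_top
    obtain ⟨h1, h2⟩ := moment (2 + δ) (by linarith) hp
    refine ⟨h1 _ (le_of_eq ?_), h2 _ (le_of_eq ?_)⟩
    · push_cast; field_simp; ring
    · push_cast; field_simp; ring
  · have hδ' : (0 : ℝ) < δ := hδ
    have hp : (∫⁻ ω, (∫⁻ u in Set.Icc (0 : ℝ) T, ‖θ u ω‖ₑ ^ (4 + δ : ℝ)) ∂P) < ∞ := by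
      refine lt_of_eq_of_lt (lintegral_congr fun ω ↦ ?_) hmom
      exact setLIntegral_congr_fun measurableSet_Icc fun u hu ↦ by
        rw [hϑ u hu ω]
    obtain ⟨h1, h2⟩ := moment (4 + δ) (by linarith) hp
    refine ⟨h1 _ ?_, h2 _ ?_⟩
    · have e : (1 : ℝ) / 2 - 1 / (4 + δ) = (2 + δ) / (8 + 2 * δ) := by field_simp; ring
      rw [e]
      push_cast
      gcongr
      linarith
    · have e : (1 : ℝ) - 2 / (4 + δ) = (2 + δ) / (4 + δ) := by field_simp; ring
      rw [e]
      push_cast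
      gcongr
      linarith
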